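/- Let $G$ be a finite directed graph with vertex set $V(G)$ and edge set $E(G)$; loops and multiple edges are allowed. For a vertex $v$, let $x_1,\dots,x_m$ be the edges with initial vertex $v$ and $y_1,\dots,y_n$ the edges with terminal vertex $v$, regarded as variables of $\mathbb{Z}[E(G)]$, and let $e_l$ denote the $l$-th elementary symmetric polynomial. Let $\tilde I(G)\subset\mathbb{Z}[E(G)]$ be the homogeneous ideal generated, over all vertices $v$, by $e_1(x_1,\dots,x_m)-e_1(y_1,\dots,y_n)$, the $e_l(x_1,\dots,x_m)$ with $2\le l\le m$, and the $e_l(y_1,\dots,y_n)$ with $2\le l\le n$. Let $$\tilde P(G)=\{p\in\mathbb{CP}^{|E(G)|-1} : f(p)=0 \text{ for all } f\in\tilde I(G)\}.$$ A directed cycle is a closed directed path without repeated vertices, considered up to circular permutation (a loop is a directed cycle). Two directed cycles are disjoint if they have no common vertex. Let $\tilde\alpha(G)$ be the maximal number of pairwise disjoint directed cycles in $G$. A collection of pairwise disjoint directed cycles is strongly maximal if it is not properly contained in another such collection, and $\tilde\gamma_n(G)$ is the number of strongly maximal collections with exactly $n$ cycles. Then: 1. $\tilde P(G)$ is a union of finitely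 many linear subspaces of $\mathbb{CP}^{|E(G)|-1}$. 2. $\dim\tilde P(G)=\tilde\alpha(G)-1$, where $\dim\emptyset=-1$. 3. If $\tilde\alpha(G)\ge 1$, that is, if $G$ contains a directed cycle, then $\deg\tilde P(G)=\tilde\gamma_{\tilde\alpha(G)}(G)$. 4. For every $n\ge 1$, $\tilde\gamma_n(G)$ is equal to the number of irreducible components of $\tilde P(G)$ of dimension $n-1$. Here dimension and irreducible components refer to the Zariski topology. The degree of a nonempty projective algebraic set of dimension $r$ is $r!$ times the leading coefficient of its Hilbert polynomial; equivalently, it is the sum of the degrees of its $r$-dimensional irreducible components. -/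

import Mathlib

open scoped LinearAlgebra.Projectivization

/-! ### Complex projective space with homogeneous coordinates indexed by `E` -/

/-- The projective space of dimension `|E| - 1` over `ℂ`, with homogeneous coordinates indexed by
`E`. -/
abbrev CProj (E : Type*) : Type _ := ℙ ℂ (E → ℂ)

namespace CProj

variable {E : Type*}

/-- The polynomial `f` (with coefficients in `R = ℤ` or `R = ℂ`) vanishes at the point `p`: it is
zero at every vector of homogeneous coordinates of `p`. -/
def Vanishes {R : Type*} [CommRing R] [Algebra R ℂ] (f : MvPolynomial E R) (p : CProj E) : Prop :=
  ∀ (v : E → ℂ) (hv : v ≠ 0), Projectivization.mk ℂ v hv = p → MvPolynomial.aeval v f = 0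

/-- The set of common zeros of a set of polynomials. -/
def zeroLocus {R : Type*} [CommRing R] [Algebra R ℂ] (F : Set (MvPolynomial E R)) :
    Set (CProj E) :=
  {p | ∀ f ∈ F, Vanishes f p}

/-- Projective algebraic sets: the common zeros of a set of homogeneous complex polynomials. -/
def algebraicSets (E : Type*) : Set (Set (CProj E)) :=
  {Z | ∃ F : Set (MvPolynomial E ℂ), (∀ f ∈ F, ∃ d : ℕ, f.IsHomogeneous d) ∧ Z = zeroLocus F}

theorem vanishes_mul {f g : MvPolynomial E ℂ} {m n : ℕ} (hf : f.IsHomogeneous m)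
    (hg : g.IsHomogeneous n) (p : CProj E) :
    Vanishes (f * g) p ↔ Vanishes f p ∨ Vanishes g p := by
  have scale : ∀ {h : MvPolynomial E ℂ} {d : ℕ}, h.IsHomogeneous d →
      MvPolynomial.aeval p.rep h = 0 → Vanishes h p := by
    intro h d hh h0 v hv hvp
    rw [← p.mk_rep, Projectivization.mk_eq_mk_iff'] at hvp
    obtain ⟨a, rfl⟩ := hvp
    have key : MvPolynomial.aeval (a • p.rep) h = a ^ d * MvPolynomial.aeval p.rep h := by
      rw [MvPolynomial.aeval_def, MvPolynomial.aeval_def, MvPolynomial.eval₂_eq,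
        MvPolynomial.eval₂_eq, Finset.mul_sum]
      refine Finset.sum_congr rfl fun m hm => ?_
      have hd : ∑ i ∈ m.support, m i = d := by
        simpa [Finsupp.weight_apply, Finsupp.sum] using hh (MvPolynomial.mem_support_iff.1 hm)
      simp only [Pi.smul_apply, smul_eq_mul, mul_pow, Finset.prod_mul_distrib,
        Finset.prod_pow_eq_pow_sum, hd]
      ring
    rw [key, h0, mul_zero]
  constructor
  · intro h
    have h1 := h p.rep p.rep_nonzero p.mk_rep
    rw [map_mul, mul_eq_zero] at h1
    exact h1.imp (scale hf) (scale hg)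
  · rintro (h | h) v hv hvp
    · rw [map_mul, h v hv hvp, zero_mul]
    · rw [map_mul, h v hv hvp, mul_zero]

/-- The Zariski topology: the closed sets are the projective algebraic sets. -/
instance zariskiTopology : TopologicalSpace (CProj E) :=
  TopologicalSpace.ofClosed (algebraicSets E)
    (by
      refine ⟨{1}, ?_, ?_⟩
      · rintro f rfl
        exact ⟨0, MvPolynomial.isHomogeneous_one E ℂ⟩
      · ext p
        simp only [Set.mem_empty_iff_false, zeroLocus, Set.mem_singleton_iff, forall_eq,
          Set.mem_ofPred_eq, false_iff]
        intro h
        simpa using h p.rep p.rep_nonzero p.mk_rep)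
    (by
      intro A hA
      choose! F hF hAF using fun Z (h : Z ∈ A) => hA h
      refine ⟨⋃ Z ∈ A, F Z, ?_, ?_⟩
      · intro f hf
        simp only [Set.mem_iUnion] at hf
        obtain ⟨Z, hZ, hfZ⟩ := hf
        exact hF Z hZ f hfZ
      · ext p
        simp only [Set.mem_sInter, zeroLocus, Set.mem_iUnion, Set.mem_ofPred_eq]
        constructor
        · rintro h f ⟨Z, hZ, hfZ⟩
          have := h Z hZ
          rw [hAF Z hZ] at this
          exact this f hfZ
        · intro h Z hZ
          rw [hAF Z hZ]
          exact fun f hf => h f ⟨Z, hZ, hf⟩)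
    (by
      rintro _ ⟨F, hF, rfl⟩ _ ⟨F', hF', rfl⟩
      refine ⟨{h | ∃ f ∈ F, ∃ g ∈ F', h = f * g}, ?_, ?_⟩
      · rintro _ ⟨f, hf, g, hg, rfl⟩
        obtain ⟨m, hm⟩ := hF f hf
        obtain ⟨n, hn⟩ := hF' g hg
        exact ⟨m + n, hm.mul hn⟩
      · ext p
        constructor
        · rintro (h | h) _ ⟨f, hf, g, hg, rfl⟩ v hv hvp
          · rw [map_mul, h f hf v hv hvp, zero_mul]
          · rw [map_mul, h g hg v hv hvp, mul_zero]
        · intro h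
          by_contra hne
          simp only [Set.mem_union, not_or, zeroLocus, Set.mem_ofPred_eq, not_forall] at hne
          obtain ⟨⟨f, hf, hfp⟩, ⟨g, hg, hgp⟩⟩ := hne
          obtain ⟨m, hm⟩ := hF f hf
          obtain ⟨n, hn⟩ := hF' g hg
          rcases (vanishes_mul hm hn p).1 (h _ ⟨f, hf, g, hg, rfl⟩) with h1 | h1
          · exact hfp h1
          · exact hgp h1)

/-- `HasDim Z d`: the topological space `Z` has dimension `d`, where the dimension is the maximal
length of a chain of irreducible closed subsets, and the empty space has dimension `-1`. -/
def HasDim (Z : Type*) [TopologicalSpace Z] (d : ℤ) : Prop :=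
  (IsEmpty Z ∧ d = -1) ∨ ∃ r : ℕ, d = r ∧ topologicalKrullDim Z = r

/-- The homogeneous vanishing ideal of a set `X` of points of projective space. -/
def vanishingIdeal (X : Set (CProj E)) : Ideal (MvPolynomial E ℂ) where
  carrier := {f | ∀ p ∈ X, Vanishes f p}
  add_mem' := by
    intro f g hf hg p hp v hv hvp
    rw [map_add, hf p hp v hv hvp, hg p hp v hv hvp, add_zero]
  zero_mem' := by
    intro p _ v _ _
    exact map_zero _
  smul_mem' := by
    intro c f hf p hp v hv hvp
    rw [smul_eq_mul, map_mul, hf p hp v hv hvp, mul_zero]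

/-- The Hilbert function of `X`: the dimension of the degree `t` part of the homogeneous coordinate
ring of `X`, that is, of the forms of degree `t` modulo those which vanish on `X`. -/
noncomputable def hilbertFunction (X : Set (CProj E)) (t : ℕ) : ℕ :=
  Module.finrank ℂ (MvPolynomial.homogeneousSubmodule E ℂ t ⧸
    ((vanishingIdeal X).restrictScalars ℂ).submoduleOf (MvPolynomial.homogeneousSubmodule E ℂ t))

/-- `HasDegree X m`: the projective algebraic set `X` has a Hilbert polynomial `P`, and the degree
of `X`, which is `r!` times the leading coefficient of `P` for `r` the degree of `P`, is `m`. -/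
def HasDegree (X : Set (CProj E)) (m : ℕ) : Prop :=
  ∃ P : Polynomial ℚ,
    (∀ᶠ t : ℕ in Filter.atTop, (hilbertFunction X t : ℚ) = P.eval (t : ℚ)) ∧
      (P.natDegree.factorial : ℚ) * P.leadingCoeff = m

end CProj

/-! ### Directed graphs -/

/-- A directed graph with vertices `V` and edges `E`; loops and multiple edges are allowed. -/
structure DirectedGraph (V E : Type*) where
  /-- The initial vertex of an edge. -/
  init : E → V
  /-- The terminal vertex of an edge. -/
  term : E → V

namespace DirectedGraph

variable {V E : Type*} (G : DirectedGraph V E)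

/-- A directed cycle `v₀, x₀, v₁, x₁, …, vₙ, xₙ, v₀`, given by the cyclic sequence (a list up to
rotation) of its edges `x₀, …, xₙ`: the sequence is not empty, the terminal vertex of each edge is
the initial vertex of the next one, and the vertices `vᵢ = init xᵢ` are pairwise distinct. -/
def IsDirectedCycle (c : Cycle E) : Prop :=
  c ≠ Cycle.nil ∧ c.Chain (fun x y => G.term x = G.init y) ∧ (c.map G.init).Nodup

/-- The type of directed cycles of `G`. -/
def DirectedCycle : Type _ := {c : Cycle E // G.IsDirectedCycle c}

/-- The set of vertices of a directed cycle. -/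
def DirectedCycle.vertices {G : DirectedGraph V E} (C : G.DirectedCycle) : Set V :=
  {v | v ∈ C.1.map G.init}

instance finiteDirectedCycle [Finite E] : Finite G.DirectedCycle := by
  classical
  have := Fintype.ofFinite E
  refine Finite.of_injective
    (β := {s : Cycle E // s.Nodup}) (fun C => ⟨C.1, ?_⟩) ?_
  · obtain ⟨c, _, _, h⟩ := C
    induction c using Quotient.inductionOn with
    | h l => exact List.Nodup.of_map _ h
  · intro C D h
    exact Subtype.ext (congrArg (fun s : {s : Cycle E // s.Nodup} => s.1) h)

/-- A collection of pairwise (vertex-)disjoint directed cycles. -/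
def PairwiseDisjointCycles (𝒞 : Finset G.DirectedCycle) : Prop :=
  (𝒞 : Set G.DirectedCycle).Pairwise fun C D => Disjoint C.vertices D.vertices

/-- A strongly maximal collection: one that is maximal under inclusion among the collections of
pairwise disjoint directed cycles. -/
def StronglyMaximal (𝒞 : Finset G.DirectedCycle) : Prop :=
  Maximal G.PairwiseDisjointCycles 𝒞

/-- The strong cycle packing number: the maximal number of pairwise disjoint directed cycles. -/
noncomputable def strongPackingNumber : ℕ :=
  sSup {k | ∃ 𝒞 : Finset G.DirectedCycle, G.PairwiseDisjointCycles 𝒞 ∧ 𝒞.card = k}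

/-- The strong cycle spectrum: the number of strongly maximal collections of exactly `n` pairwise
disjoint directed cycles. -/
noncomputable def strongSpectrum (n : ℕ) : ℕ :=
  {𝒞 : Finset G.DirectedCycle | G.StronglyMaximal 𝒞 ∧ 𝒞.card = n}.ncard

section Incidence

variable [Fintype E]

open Classical in
/-- The edges which have `v` as their initial vertex. -/
noncomputable def outEdges (v : V) : Finset E := Finset.univ.filter fun x => G.init x = v

open Classical in
/-- The edges which have `v` as their terminal vertex. -/
noncomputable def inEdges (v : V) : Finset E := Finset.univ.filter fun x => G.term x = v

/-- The `l`-th elementary symmetric polynomial in the variables that belong to the edges in `s`. -/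
noncomputable def elemSymm (s : Finset E) (l : ℕ) : MvPolynomial E ℤ :=
  ∑ t ∈ s.powersetCard l, ∏ x ∈ t, MvPolynomial.X x

/-- The strong incidence relations at the vertex `v`. -/
def strongRelationsAt (v : V) : Set (MvPolynomial E ℤ) :=
  {elemSymm (G.outEdges v) 1 - elemSymm (G.inEdges v) 1} ∪
    {f | ∃ l, 2 ≤ l ∧ l ≤ (G.outEdges v).card ∧ f = elemSymm (G.outEdges v) l} ∪
    {f | ∃ l, 2 ≤ l ∧ l ≤ (G.inEdges v).card ∧ f = elemSymm (G.inEdges v) l}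

/-- The strong incidence ideal, generated by all the strong incidence relations. -/
noncomputable def strongIncidenceIdeal : Ideal (MvPolynomial E ℤ) :=
  Ideal.span (⋃ v : V, G.strongRelationsAt v)

/-- The strong incidence set: the points of complex projective space at which all the polynomials
of the strong incidence ideal vanish. -/
def strongIncidenceSet : Set (CProj E) :=
  CProj.zeroLocus (G.strongIncidenceIdeal : Set (MvPolynomial E ℤ))

end Incidence

end DirectedGraph

open MvPolynomial Filter Topology TopologicalSpace

/-!
At a vertex, the relations `e_l = 0` for `l ≥ 2` say that at most one edge out of the vertex and at
most one edge into it carry a nonzero weight, and the linear relation is conservation of flow. So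
the support of a solution is a disjoint union of directed cycles, along each of which the weight is
constant, and the solutions are the linear combinations of the indicator functions of pairwise
disjoint directed cycles. Every packing of `k` disjoint cycles contributes a linear subspace of
dimension `k`, and inclusion of subspaces is inclusion of packings. The irreducible components are
therefore the subspaces of the strongly maximal packings.

For the degree of a union `X` of linear subspaces of projective dimension at most `r`, choose for
each `r`-dimensional subspace `Wᵢ` a form `gᵢ`, of degree `nᵢ`, which vanishes on the other ones but
not on `Wᵢ`. The map `(fᵢ)ᵢ ↦ ∑ gᵢ fᵢ` bounds the Hilbert function of `X` from below by
`∑ i, binom(t - nᵢ + r, r)`, and the sum of the Hilbert functions of all the subspaces bounds it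
from above. Both are asymptotic to `t ^ r / r!` times the number of `r`-dimensional subspaces. That
the Hilbert function is eventually a polynomial is proved by counting the monomials outside the
initial ideal.
-/

theorem aeval_smul_of_isHomogeneous {σ R S : Type*} [CommSemiring R] [CommSemiring S] [Algebra R S]
    {f : MvPolynomial σ R} {d : ℕ} (hf : f.IsHomogeneous d) (a : S) (v : σ → S) :
    aeval (a • v) f = a ^ d * aeval v f := by
  simp only [aeval_def, eval₂_eq, Finset.mul_sum]
  refine Finset.sum_congr rfl fun m hm => ?_
  have hd : ∑ i ∈ m.support, m i = d := (hf.degree_eq_sum_deg_support hm).symm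
  simp only [Pi.smul_apply, smul_eq_mul, mul_pow, Finset.prod_mul_distrib,
    Finset.prod_pow_eq_pow_sum, hd]
  exact mul_left_comm _ _ _

namespace CProj

/-! ### Vanishing ideals -/

section Vanishing

variable {E : Type*}

/-- The restriction of a polynomial to the line spanned by `v`, as a polynomial in the parameter
of the line. -/
noncomputable def restrictLine (v : E → ℂ) : MvPolynomial E ℂ →ₐ[ℂ] Polynomial ℂ :=
  aeval fun e => Polynomial.C (v e) * Polynomial.X

theorem eval_restrictLine (v : E → ℂ) (f : MvPolynomial E ℂ) (a : ℂ) :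
    (restrictLine v f).eval a = aeval (a • v) f := by
  have h : (Polynomial.aeval a).comp (restrictLine v) = aeval (a • v) := by
    ext e
    simp [restrictLine, mul_comm a]
  simpa only [AlgHom.comp_apply, Polynomial.coe_aeval_eq_eval] using DFunLike.congr_fun h f

theorem restrictLine_of_isHomogeneous {f : MvPolynomial E ℂ} {d : ℕ} (hf : f.IsHomogeneous d)
    (v : E → ℂ) : restrictLine v f = Polynomial.C (aeval v f) * Polynomial.X ^ d := by
  refine Polynomial.funext fun a => ?_
  rw [eval_restrictLine, aeval_smul_of_isHomogeneous hf, Polynomial.eval_mul, Polynomial.eval_C,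
    Polynomial.eval_pow, Polynomial.eval_X, mul_comm]

theorem coeff_restrictLine (v : E → ℂ) (f : MvPolynomial E ℂ) (n : ℕ) :
    (restrictLine v f).coeff n = aeval v (homogeneousComponent n f) := by
  conv_lhs => rw [← sum_homogeneousComponent f]
  simp only [map_sum, Polynomial.finsetSum_coeff, Polynomial.coeff_C_mul_X_pow,
    restrictLine_of_isHomogeneous (homogeneousComponent_isHomogeneous _ f)]
  rw [Finset.sum_ite_eq, ite_eq_left_iff]
  intro h
  rw [homogeneousComponent_eq_zero _ _ (by simpa using h), map_zero]

theorem vanishes_mk_iff {R : Type*} [CommRing R] [Algebra R ℂ] (f : MvPolynomial E R)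
    (v : E → ℂ) (hv : v ≠ 0) :
    Vanishes f (Projectivization.mk ℂ v hv) ↔ ∀ a : ℂ, a ≠ 0 → aeval (a • v) f = 0 := by
  constructor
  · intro h a ha
    exact h (a • v) (smul_ne_zero ha hv) ((Projectivization.mk_eq_mk_iff' ..).2 ⟨a, rfl⟩)
  · intro h w hw hwv
    obtain ⟨a, rfl⟩ := (Projectivization.mk_eq_mk_iff' ..).1 hwv
    exact h a (left_ne_zero_of_smul hw)

theorem vanishes_mk_iff_restrictLine_eq_zero (f : MvPolynomial E ℂ) (v : E → ℂ) (hv : v ≠ 0) :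
    Vanishes f (Projectivization.mk ℂ v hv) ↔ restrictLine v f = 0 := by
  simp only [vanishes_mk_iff, ← eval_restrictLine]
  constructor
  · intro h
    exact Polynomial.eq_zero_of_infinite_isRoot _
      ((Set.finite_singleton (0 : ℂ)).infinite_compl.mono h)
  · intro h a _
    rw [h, Polynomial.eval_zero]

theorem vanishes_mk_iff_of_isHomogeneous {R : Type*} [CommRing R] [Algebra R ℂ]
    {f : MvPolynomial E R} {d : ℕ} (hf : f.IsHomogeneous d) (v : E → ℂ) (hv : v ≠ 0) :
    Vanishes f (Projectivization.mk ℂ v hv) ↔ aeval v f = 0 := by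
  rw [vanishes_mk_iff]
  constructor
  · intro h
    simpa using h 1 one_ne_zero
  · intro h a _
    rw [aeval_smul_of_isHomogeneous hf, h, mul_zero]

theorem vanishes_mul_iff (f g : MvPolynomial E ℂ) (p : CProj E) :
    Vanishes (f * g) p ↔ Vanishes f p ∨ Vanishes g p := by
  induction p using Projectivization.ind with
  | h v hv => simp only [vanishes_mk_iff_restrictLine_eq_zero, map_mul, mul_eq_zero]

theorem vanishes_iff_forall_homogeneousComponent (f : MvPolynomial E ℂ) (p : CProj E) :
    Vanishes f p ↔ ∀ n, Vanishes (homogeneousComponent n f) p := by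
  induction p using Projectivization.ind with
  | h v hv =>
    simp only [vanishes_mk_iff_of_isHomogeneous (homogeneousComponent_isHomogeneous _ f),
      vanishes_mk_iff_restrictLine_eq_zero, Polynomial.ext_iff, coeff_restrictLine,
      Polynomial.coeff_zero]

theorem mem_vanishingIdeal_iff_forall_homogeneousComponent {X : Set (CProj E)}
    {f : MvPolynomial E ℂ} :
    f ∈ vanishingIdeal X ↔ ∀ n, homogeneousComponent n f ∈ vanishingIdeal X :=
  ⟨fun h n p hp => (vanishes_iff_forall_homogeneousComponent f p).1 (h p hp) n,
    fun h p hp => (vanishes_iff_forall_homogeneousComponent f p).2 fun n => h n p hp⟩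

theorem isClosed_iff_mem_algebraicSets {Z : Set (CProj E)} :
    IsClosed Z ↔ Z ∈ algebraicSets E := by
  rw [← isOpen_compl_iff]
  change Zᶜᶜ ∈ algebraicSets E ↔ _
  rw [compl_compl]

theorem isClosed_zeroLocus (F : Set (MvPolynomial E ℂ)) : IsClosed (zeroLocus F) := by
  refine isClosed_iff_mem_algebraicSets.2
    ⟨{g | ∃ f ∈ F, ∃ n, homogeneousComponent n f = g}, ?_, ?_⟩
  · rintro _ ⟨f, -, n, rfl⟩
    exact ⟨n, homogeneousComponent_isHomogeneous n f⟩
  · ext p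
    constructor
    · rintro h _ ⟨f, hf, n, rfl⟩
      exact (vanishes_iff_forall_homogeneousComponent f p).1 (h f hf) n
    · intro h f hf
      exact (vanishes_iff_forall_homogeneousComponent f p).2 fun n => h _ ⟨f, hf, n, rfl⟩

theorem isClosed_iff_zeroLocus_vanishingIdeal {Z : Set (CProj E)} :
    IsClosed Z ↔ zeroLocus (vanishingIdeal Z : Set (MvPolynomial E ℂ)) = Z := by
  constructor
  · intro h
    obtain ⟨F, -, rfl⟩ := isClosed_iff_mem_algebraicSets.1 h
    exact Set.Subset.antisymm (fun p hp f hf => hp f fun q hq => hq f hf)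
      fun p hp f hf => hf p hp
  · intro h
    rw [← h]
    exact isClosed_zeroLocus _

theorem vanishingIdeal_anti {Z W : Set (CProj E)} (h : Z ⊆ W) :
    vanishingIdeal W ≤ vanishingIdeal Z := fun _ hf p hp => hf p (h hp)

theorem vanishingIdeal_strictAnti {Z W : Set (CProj E)} (hZ : IsClosed Z) (hW : IsClosed W)
    (h : Z ⊂ W) : vanishingIdeal W < vanishingIdeal Z := by
  refine lt_of_le_of_ne (vanishingIdeal_anti h.subset) fun heq => h.ne ?_
  rw [← isClosed_iff_zeroLocus_vanishingIdeal.1 hZ, ← heq,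
    isClosed_iff_zeroLocus_vanishingIdeal.1 hW]

theorem isPrime_vanishingIdeal {Z : Set (CProj E)} (hZ : IsIrreducible Z) :
    (vanishingIdeal Z).IsPrime := by
  obtain ⟨p, hp⟩ := hZ.nonempty
  refine Ideal.isPrime_iff.2 ⟨?_, fun {f g} hfg => ?_⟩
  · rw [Ideal.ne_top_iff_one]
    intro h
    simpa using h p hp p.rep p.rep_nonzero p.mk_rep
  · have hcover : Z ⊆ zeroLocus {f} ∪ zeroLocus {g} := fun q hq => by
      simpa only [zeroLocus, Set.mem_union, Set.mem_ofPred_eq, Set.mem_singleton_iff,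
        forall_eq] using (vanishes_mul_iff f g q).1 (hfg q hq)
    exact (isPreirreducible_iff_isClosed_union_isClosed.1 hZ.isPreirreducible _ _
      (isClosed_zeroLocus _) (isClosed_zeroLocus _) hcover).imp
        (fun h q hq => h hq f rfl) (fun h q hq => h hq g rfl)

theorem isPreirreducible_of_isPrime_vanishingIdeal {Z : Set (CProj E)}
    (hZ : (vanishingIdeal Z).IsPrime) : IsPreirreducible Z := by
  refine isPreirreducible_iff_isClosed_union_isClosed.2 fun Y W hY hW hcover => ?_
  by_contra! hne
  rw [← isClosed_iff_zeroLocus_vanishingIdeal.1 hY,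
    ← isClosed_iff_zeroLocus_vanishingIdeal.1 hW] at hne
  obtain ⟨⟨p, hpZ, hp⟩, q, hqZ, hq⟩ := hne.imp Set.not_subset.1 Set.not_subset.1
  simp only [zeroLocus, Set.mem_ofPred_eq, not_forall] at hp hq
  obtain ⟨f, hf, hfp⟩ := hp
  obtain ⟨g, hg, hgq⟩ := hq
  have hfg : f * g ∈ vanishingIdeal Z := fun r hr =>
    (vanishes_mul_iff f g r).2 ((hcover hr).imp (hf r) (hg r))
  exact (hZ.mem_or_mem hfg).elim (fun h => hfp (h p hpZ)) fun h => hgq (h q hqZ)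

/-- The ideal of the polynomials without constant term. It lies strictly above the vanishing ideal
of every nonempty set, which makes the Krull dimension of the polynomial ring exceed that of the
projective space by one. -/
noncomputable def irrelevantIdeal (E : Type*) : Ideal (MvPolynomial E ℂ) :=
  RingHom.ker (constantCoeff : MvPolynomial E ℂ →+* ℂ)

instance isPrime_irrelevantIdeal : (irrelevantIdeal E).IsPrime := RingHom.ker_isPrime _

theorem constantCoeff_eq_zero_of_vanishes {f : MvPolynomial E ℂ} {p : CProj E}
    (h : Vanishes f p) : constantCoeff f = 0 := by
  rw [← p.mk_rep, vanishes_mk_iff_restrictLine_eq_zero] at h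
  have h0 : (restrictLine p.rep f).coeff 0 = 0 := by rw [h, Polynomial.coeff_zero]
  simpa [coeff_restrictLine, constantCoeff_eq] using h0

theorem vanishingIdeal_lt_irrelevantIdeal {Z : Set (CProj E)} (hZ : Z.Nonempty) :
    vanishingIdeal Z < irrelevantIdeal E := by
  obtain ⟨p, hp⟩ := hZ
  refine lt_of_le_of_ne (fun f hf => constantCoeff_eq_zero_of_vanishes (hf p hp)) fun h => ?_
  refine p.rep_nonzero (funext fun e => ?_)
  have he : (X e : MvPolynomial E ℂ) ∈ vanishingIdeal Z := by
    rw [h, irrelevantIdeal, RingHom.mem_ker, constantCoeff_X]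
  simpa using he p hp p.rep p.rep_nonzero p.mk_rep

theorem vanishingIdeal_univ [Nonempty E] : vanishingIdeal (Set.univ : Set (CProj E)) = ⊥ := by
  refine (Submodule.eq_bot_iff _).2 fun f hf => MvPolynomial.funext fun v => ?_
  rw [map_zero]
  by_cases hv : v = 0
  · obtain ⟨w, hw⟩ := exists_ne (0 : E → ℂ)
    have hf0 : constantCoeff f = 0 :=
      constantCoeff_eq_zero_of_vanishes (hf (Projectivization.mk ℂ w hw) (Set.mem_univ _))
    rw [hv, eval_zero, hf0]
  · simpa [aeval_def] using hf (Projectivization.mk ℂ v hv) (Set.mem_univ _) v hv rfl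

end Vanishing

/-! ### Linear maps and linear subspaces -/

section Linear

variable {σ E : Type*}

section LinearForm

variable [Fintype σ]

open Classical in
/-- A linear functional on `σ → ℂ`, as a linear form in the coordinates. -/
noncomputable def linearForm (φ : Module.Dual ℂ (σ → ℂ)) : MvPolynomial σ ℂ :=
  ∑ s, C (φ (Pi.single s 1)) * X s

theorem isHomogeneous_linearForm (φ : Module.Dual ℂ (σ → ℂ)) : (linearForm φ).IsHomogeneous 1 :=
  IsHomogeneous.sum _ _ _ fun s _ => isHomogeneous_C_mul_X _ s

theorem aeval_linearForm (φ : Module.Dual ℂ (σ → ℂ)) (v : σ → ℂ) :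
    aeval v (linearForm φ) = φ v := by
  classical
  conv_rhs => rw [pi_eq_sum_univ' v]
  simp only [linearForm, map_sum, map_mul, aeval_C, aeval_X, map_smul, Algebra.algebraMap_self,
    RingHom.id_apply, smul_eq_mul, mul_comm]

/-- The substitution of the coordinates of a linear map `A`, that is, `f ↦ f ∘ A` on polynomial
functions. -/
noncomputable def pullback (A : (σ → ℂ) →ₗ[ℂ] (E → ℂ)) : MvPolynomial E ℂ →ₐ[ℂ] MvPolynomial σ ℂ :=
  aeval fun e => linearForm (LinearMap.proj e ∘ₗ A)

theorem aeval_pullback (A : (σ → ℂ) →ₗ[ℂ] (E → ℂ)) (f : MvPolynomial E ℂ) (v : σ → ℂ) :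
    aeval v (pullback A f) = aeval (A v) f := by
  have h : (aeval v).comp (pullback A) = aeval (A v) := by
    ext e
    rw [AlgHom.comp_apply, pullback, aeval_X, aeval_X, aeval_linearForm]
    rfl
  exact DFunLike.congr_fun h f

theorem isHomogeneous_pullback (A : (σ → ℂ) →ₗ[ℂ] (E → ℂ)) {f : MvPolynomial E ℂ} {d : ℕ}
    (hf : f.IsHomogeneous d) : (pullback A f).IsHomogeneous d := by
  rw [← one_mul d]
  exact hf.aeval _ fun _ => isHomogeneous_linearForm _

theorem vanishes_pullback_mk_iff (A : (σ → ℂ) →ₗ[ℂ] (E → ℂ)) (f : MvPolynomial E ℂ) {v : σ → ℂ}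
    (hv : v ≠ 0) (hAv : A v ≠ 0) :
    Vanishes (pullback A f) (Projectivization.mk ℂ v hv) ↔
      Vanishes f (Projectivization.mk ℂ (A v) hAv) := by
  simp only [vanishes_mk_iff, aeval_pullback, map_smul]

theorem vanishes_pullback_iff {A : (σ → ℂ) →ₗ[ℂ] (E → ℂ)} (hA : Function.Injective A)
    (f : MvPolynomial E ℂ) (p : CProj σ) :
    Vanishes (pullback A f) p ↔ Vanishes f (Projectivization.map A hA p) := by
  induction p using Projectivization.ind with
  | h v hv => exact vanishes_pullback_mk_iff A f hv _

end LinearForm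

theorem isInducing_map [Finite σ] [Finite E] {A : (σ → ℂ) →ₗ[ℂ] (E → ℂ)}
    (hA : Function.Injective A) : IsInducing (Projectivization.map A hA) := by
  cases nonempty_fintype σ
  cases nonempty_fintype E
  obtain ⟨B, hBA⟩ := A.exists_leftInverse_of_injective (LinearMap.ker_eq_bot.2 hA)
  have hBA' (v : σ → ℂ) : B (A v) = v := LinearMap.congr_fun hBA v
  refine ⟨TopologicalSpace.ext_iff_isClosed.2 fun Z => ?_⟩
  rw [isClosed_induced_iff]
  constructor
  · intro hZ
    refine ⟨zeroLocus (pullback B '' vanishingIdeal Z), isClosed_zeroLocus _, ?_⟩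
    conv_rhs => rw [← isClosed_iff_zeroLocus_vanishingIdeal.1 hZ]
    ext p
    simp only [zeroLocus, Set.mem_preimage, Set.mem_ofPred_eq, Set.forall_mem_image]
    refine forall₂_congr fun f _ => ?_
    induction p using Projectivization.ind with
    | h v hv =>
      rw [Projectivization.map_mk, vanishes_pullback_mk_iff B f _ (by rwa [hBA'])]
      simp only [hBA']
  · rintro ⟨Y, hY, rfl⟩
    rw [← isClosed_iff_zeroLocus_vanishingIdeal.1 hY]
    convert isClosed_zeroLocus (pullback A '' vanishingIdeal Y) using 1
    ext p
    simp only [zeroLocus, Set.mem_preimage, Set.mem_ofPred_eq, Set.forall_mem_image,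
      vanishes_pullback_iff hA]

theorem range_map {A : (σ → ℂ) →ₗ[ℂ] (E → ℂ)} (hA : Function.Injective A) :
    Set.range (Projectivization.map A hA) = (LinearMap.range A).projectivization := by
  ext p
  induction p using Projectivization.ind with
  | h w hw =>
    constructor
    · rintro ⟨q, hq⟩
      induction q using Projectivization.ind with
      | h v hv =>
        rw [← hq]
        exact LinearMap.mem_range_self A v
    · rintro ⟨v, rfl⟩
      exact ⟨Projectivization.mk ℂ v fun hv => hw (by rw [hv, map_zero]), rfl⟩

theorem isClosed_projectivization [Finite E] (W : Submodule ℂ (E → ℂ)) :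
    IsClosed (W.projectivization : Set (CProj E)) := by
  cases nonempty_fintype E
  convert isClosed_zeroLocus (linearForm '' {φ | W ≤ LinearMap.ker φ}) using 1
  ext p
  induction p using Projectivization.ind with
  | h v hv =>
    simp only [zeroLocus, Set.mem_ofPred_eq, Set.forall_mem_image,
      vanishes_mk_iff_of_isHomogeneous (isHomogeneous_linearForm _), aeval_linearForm]
    constructor
    · intro hvW φ hφ
      exact hφ hvW
    · intro h
      by_contra hvW
      obtain ⟨φ, hφv, hφ⟩ := Submodule.exists_le_ker_of_notMem hvW
      exact hφv (h hφ)

theorem isClosedEmbedding_map [Finite σ] [Finite E] {A : (σ → ℂ) →ₗ[ℂ] (E → ℂ)}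
    (hA : Function.Injective A) : IsClosedEmbedding (Projectivization.map A hA) where
  toIsInducing := isInducing_map hA
  injective := Projectivization.map_injective A hA
  isClosed_range := by
    rw [range_map hA]
    exact isClosed_projectivization _

theorem exists_injective_range_eq [Finite E] (W : Submodule ℂ (E → ℂ)) :
    ∃ A : (Fin (Module.finrank ℂ W) → ℂ) →ₗ[ℂ] (E → ℂ),
      Function.Injective A ∧ LinearMap.range A = W := by
  let e := (Module.finBasis ℂ W).equivFun.symm
  exact ⟨W.subtype ∘ₗ e, W.injective_subtype.comp e.injective, by
    rw [LinearMap.range_comp, LinearEquiv.range, Submodule.map_top, Submodule.range_subtype]⟩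

theorem isPreirreducible_univ : IsPreirreducible (Set.univ : Set (CProj E)) := by
  cases isEmpty_or_nonempty E
  · exact (Set.subsingleton_of_subsingleton).isPreirreducible
  · refine isPreirreducible_of_isPrime_vanishingIdeal ?_
    rw [vanishingIdeal_univ]
    exact Ideal.isPrime_bot

theorem isPreirreducible_projectivization [Finite E] (W : Submodule ℂ (E → ℂ)) :
    IsPreirreducible (W.projectivization : Set (CProj E)) := by
  obtain ⟨A, hA, hAW⟩ := exists_injective_range_eq W
  rw [← hAW, ← range_map hA, ← Set.image_univ]
  exact isPreirreducible_univ.image _ (isInducing_map hA).continuous.continuousOn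

theorem projectivization_nonempty_iff {W : Submodule ℂ (E → ℂ)} :
    (W.projectivization : Set (CProj E)).Nonempty ↔ W ≠ ⊥ := by
  rw [Submodule.ne_bot_iff]
  constructor
  · rintro ⟨p, hp⟩
    induction p using Projectivization.ind with
    | h v hv => exact ⟨v, hp, hv⟩
  · rintro ⟨v, hvW, hv⟩
    exact ⟨Projectivization.mk ℂ v hv, hvW⟩

end Linear

end CProj

/-! ### Dimension and components of a finite union of closed sets -/

section FiniteCover

variable {X Y : Type*} [TopologicalSpace X] [TopologicalSpace Y]

theorem topologicalKrullDim_image_eq {f : X → Y} (hf : IsEmbedding f) (s : Set X) :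
    topologicalKrullDim (f '' s) = topologicalKrullDim s :=
  ((hf.homeomorphImage s).isHomeomorph.topologicalKrullDim_eq _).symm

theorem topologicalKrullDim_range_eq {f : X → Y} (hf : IsEmbedding f) :
    topologicalKrullDim (Set.range f) = topologicalKrullDim X :=
  (hf.toHomeomorph.isHomeomorph.topologicalKrullDim_eq _).symm

theorem isIrreducible_of_isIrreducible_image {f : X → Y} (hf : IsInducing f) {s : Set X}
    (hs : IsIrreducible (f '' s)) : IsIrreducible s := by
  refine ⟨Set.image_nonempty.1 hs.nonempty, ?_⟩
  intro U V hU hV hsU hsV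
  obtain ⟨U', hU', rfl⟩ := hf.isOpen_iff.1 hU
  obtain ⟨V', hV', rfl⟩ := hf.isOpen_iff.1 hV
  rw [← Set.image_inter_nonempty_iff] at hsU hsV
  rw [← Set.preimage_inter, ← Set.image_inter_nonempty_iff]
  exact hs.isPreirreducible U' V' hU' hV' hsU hsV

theorem exists_subset_of_subset_iUnion {ι : Type*} [Finite ι] {Z : ι → Set X}
    (hZ : ∀ i, IsClosed (Z i)) {s : Set X} (hs : IsIrreducible s) (h : s ⊆ ⋃ i, Z i) :
    ∃ i, s ⊆ Z i := by
  have hfin := Set.finite_range Z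
  obtain ⟨z, hz, hsz⟩ := isIrreducible_iff_sUnion_isClosed.1 hs hfin.toFinset
    (by simpa only [Set.Finite.mem_toFinset, Set.forall_mem_range] using hZ)
    (by rwa [Set.Finite.coe_toFinset, Set.sUnion_range])
  obtain ⟨i, rfl⟩ := hfin.mem_toFinset.1 hz
  exact ⟨i, hsz⟩

theorem height_le_topologicalKrullDim {Z : Set X} {S : IrreducibleCloseds X}
    (hS : (S : Set X) ⊆ Z) : (Order.height S : WithBot ℕ∞) ≤ topologicalKrullDim Z := by
  have himage (T : Set.Iic S) : (Subtype.val '' (Subtype.val ⁻¹' (T : Set X) : Set Z)) = T := by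
    rw [Subtype.image_preimage_coe, Set.inter_eq_right]
    exact Set.Subset.trans T.2 hS
  let restrict (T : Set.Iic S) : IrreducibleCloseds Z :=
    { carrier := Subtype.val ⁻¹' (T : Set X)
      isIrreducible' := isIrreducible_of_isIrreducible_image IsInducing.subtypeVal <| by
        rw [himage]
        exact T.1.isIrreducible
      isClosed' := T.1.isClosed.preimage continuous_subtype_val }
  rw [Order.height_eq_krullDim_Iic]
  refine Order.krullDim_le_of_strictMono restrict
    (Monotone.strictMono_of_injective (fun T U hTU _ hx => hTU hx) fun T U hTU => ?_)
  refine Subtype.ext (SetLike.coe_injective ?_)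
  rw [← himage T, ← himage U]
  exact congrArg (fun R : IrreducibleCloseds Z => Subtype.val '' (R : Set Z)) hTU

variable {ι : Type*} [Finite ι] {Z : ι → Set X}

theorem topologicalKrullDim_le_of_iUnion_eq_univ (hZ : ∀ i, IsClosed (Z i))
    (hcover : ⋃ i, Z i = Set.univ) {d : WithBot ℕ∞} (hd : ∀ i, topologicalKrullDim (Z i) ≤ d) :
    topologicalKrullDim X ≤ d := by
  rw [topologicalKrullDim, Order.krullDim_eq_iSup_height]
  refine iSup_le fun S => ?_
  obtain ⟨i, hi⟩ := exists_subset_of_subset_iUnion hZ S.isIrreducible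
    ((Set.subset_univ _).trans hcover.superset)
  exact (height_le_topologicalKrullDim hi).trans (hd i)

theorem mem_irreducibleComponents_iff_maximal_mem_range (hZ : ∀ i, IsClosed (Z i))
    (hirr : ∀ i, IsPreirreducible (Z i)) (hcover : ⋃ i, Z i = Set.univ) {s : Set X} :
    s ∈ irreducibleComponents X ↔ s.Nonempty ∧ Maximal (· ∈ Set.range Z) s := by
  have hsub {t : Set X} (ht : IsIrreducible t) : ∃ i, t ⊆ Z i :=
    exists_subset_of_subset_iUnion hZ ht ((Set.subset_univ _).trans hcover.superset)
  constructor
  · intro hs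
    obtain ⟨i, hi⟩ := hsub hs.prop
    obtain rfl := hs.eq_of_subset ⟨hs.prop.nonempty.mono hi, hirr i⟩ hi
    refine ⟨hs.prop.nonempty, ⟨i, rfl⟩, ?_⟩
    rintro _ ⟨j, rfl⟩ hij
    exact hs.le_of_ge ⟨hs.prop.nonempty.mono hij, hirr j⟩ hij
  · rintro ⟨hne, ⟨i, rfl⟩, hmax⟩
    refine ⟨⟨hne, hirr i⟩, fun t ht hit => ?_⟩
    obtain ⟨j, hj⟩ := hsub ht
    exact hj.trans (hmax ⟨j, rfl⟩ (hit.trans hj))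

end FiniteCover

namespace CProj

theorem hasDim_natCast_iff {Z : Type*} [TopologicalSpace Z] {r : ℕ} :
    HasDim Z r ↔ topologicalKrullDim Z = r := by
  constructor
  · rintro (⟨-, hr⟩ | ⟨s, hrs, hs⟩)
    · omega
    · rwa [Nat.cast_injective hrs]
  · exact fun h => Or.inr ⟨r, rfl, h⟩

section Dimension

variable {E : Type*} [Finite E]

theorem topologicalKrullDim_add_one_le [Nonempty E] :
    topologicalKrullDim (CProj E) + 1 ≤ Nat.card E := by
  have : Nonempty (IrreducibleCloseds (CProj E)) :=
    ⟨⟨Set.univ, ⟨Set.univ_nonempty, isPreirreducible_univ⟩, isClosed_univ⟩⟩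
  let toPrime : WithBot (IrreducibleCloseds (CProj E)) → (PrimeSpectrum (MvPolynomial E ℂ))ᵒᵈ :=
    WithBot.recBotCoe (.toDual ⟨irrelevantIdeal E, isPrime_irrelevantIdeal⟩)
      fun Z => .toDual ⟨vanishingIdeal Z, isPrime_vanishingIdeal Z.isIrreducible⟩
  have htoPrime : StrictMono toPrime := WithBot.strictMono_iff.2
    ⟨fun Z W h => vanishingIdeal_strictAnti Z.isClosed W.isClosed h,
      fun Z => vanishingIdeal_lt_irrelevantIdeal Z.isIrreducible.nonempty⟩
  calc topologicalKrullDim (CProj E) + 1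
      = Order.krullDim (WithBot (IrreducibleCloseds (CProj E))) := Order.krullDim_withBot.symm
    _ ≤ Order.krullDim (PrimeSpectrum (MvPolynomial E ℂ))ᵒᵈ :=
        Order.krullDim_le_of_strictMono toPrime htoPrime
    _ = ringKrullDim (MvPolynomial E ℂ) := Order.krullDim_orderDual
    _ = Nat.card E := by
        rw [MvPolynomial.ringKrullDim_of_isNoetherianRing, ringKrullDim_eq_zero_of_field, zero_add]

theorem le_topologicalKrullDim_add_one [Nonempty E] :
    Nat.card E ≤ topologicalKrullDim (CProj E) + 1 := by
  classical
  cases nonempty_fintype E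
  have : Nonempty (IrreducibleCloseds (CProj E)) :=
    ⟨⟨Set.univ, ⟨Set.univ_nonempty, isPreirreducible_univ⟩, isClosed_univ⟩⟩
  let toClosed (W : {W : Submodule ℂ (E → ℂ) // W ≠ ⊥}) : IrreducibleCloseds (CProj E) :=
    ⟨W.1.projectivization, ⟨projectivization_nonempty_iff.2 W.2,
      isPreirreducible_projectivization W.1⟩, isClosed_projectivization W.1⟩
  have htoClosed : StrictMono toClosed := fun W W' h =>
    SetLike.coe_ssubset_coe.2 (Submodule.projectivization.strictMono h)
  calc (Nat.card E : WithBot ℕ∞)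
      = Order.krullDim (Submodule ℂ (E → ℂ)) := by
        rw [← Module.coe_length, Module.length_eq_finrank, Module.finrank_fintype_fun_eq_card,
          Nat.card_eq_fintype_card]
        rfl
    _ = Order.krullDim (WithBot {W : Submodule ℂ (E → ℂ) // W ≠ ⊥}) :=
        (Order.krullDim_eq_of_orderIso WithBot.subtypeOrderIso).symm
    _ ≤ Order.krullDim (WithBot (IrreducibleCloseds (CProj E))) :=
        Order.krullDim_le_of_strictMono _ htoClosed.withBot_map
    _ = topologicalKrullDim (CProj E) + 1 := Order.krullDim_withBot

theorem topologicalKrullDim_eq {r : ℕ} (h : Nat.card E = r + 1) :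
    topologicalKrullDim (CProj E) = r := by
  have : Nonempty E := (Nat.card_pos_iff.1 (by omega)).1
  refine ENat.WithBot.add_one_cancel.1 ?_
  rw [le_antisymm topologicalKrullDim_add_one_le le_topologicalKrullDim_add_one, h]
  rfl

theorem topologicalKrullDim_projectivization {W : Submodule ℂ (E → ℂ)} {r : ℕ}
    (h : Module.finrank ℂ W = r + 1) :
    topologicalKrullDim (W.projectivization : Set (CProj E)) = r := by
  obtain ⟨A, hA, hAW⟩ := exists_injective_range_eq W
  conv_lhs => rw [← hAW, ← range_map hA]
  rw [topologicalKrullDim_range_eq (isClosedEmbedding_map hA).isEmbedding]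
  exact topologicalKrullDim_eq (by rw [Nat.card_fin, h])

end Dimension

/-! ### Arrangements of linear subspaces -/

section Arrangement

variable {E : Type*}

/-- The union of a collection of linear subspaces of projective space, of arbitrary dimensions.
The subspaces are given by the corresponding spaces of vectors, so that `⊥` stands for `∅`. -/
def arrangement (𝒲 : Set (Submodule ℂ (E → ℂ))) : Set (CProj E) :=
  ⋃ W ∈ 𝒲, W.projectivization

variable {𝒲 : Set (Submodule ℂ (E → ℂ))}

theorem mk_mem_arrangement_iff {v : E → ℂ} {hv : v ≠ 0} :
    Projectivization.mk ℂ v hv ∈ arrangement 𝒲 ↔ ∃ W ∈ 𝒲, v ∈ W := by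
  simp only [arrangement, Set.mem_iUnion₂, SetLike.mem_coe, exists_prop,
    Submodule.mk_mem_projectivization_iff]

theorem projectivization_subset_arrangement {W : Submodule ℂ (E → ℂ)} (hW : W ∈ 𝒲) :
    (W.projectivization : Set (CProj E)) ⊆ arrangement 𝒲 :=
  Set.subset_biUnion_of_mem (u := fun W => (Submodule.projectivization W : Set (CProj E))) hW

/-- The part of a linear subspace inside an arrangement, as a subset of the arrangement. -/
def arrangementPiece (𝒲 : Set (Submodule ℂ (E → ℂ))) (W : Submodule ℂ (E → ℂ)) :
    Set (arrangement 𝒲) :=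
  Subtype.val ⁻¹' (W.projectivization : Set (CProj E))

theorem image_arrangementPiece {W : Submodule ℂ (E → ℂ)} (hW : W ∈ 𝒲) :
    Subtype.val '' arrangementPiece 𝒲 W = (W.projectivization : Set (CProj E)) := by
  rw [arrangementPiece, Subtype.image_preimage_coe, Set.inter_eq_right]
  exact projectivization_subset_arrangement hW

theorem arrangementPiece_subset_iff {W W' : Submodule ℂ (E → ℂ)} (hW : W ∈ 𝒲) (hW' : W' ∈ 𝒲) :
    arrangementPiece 𝒲 W ⊆ arrangementPiece 𝒲 W' ↔ W ≤ W' := by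
  rw [← Set.image_subset_image_iff Subtype.val_injective, image_arrangementPiece hW,
    image_arrangementPiece hW', SetLike.coe_subset_coe, OrderIso.le_iff_le]

theorem iUnion_arrangementPiece : ⋃ W : 𝒲, arrangementPiece 𝒲 W = Set.univ := by
  refine Set.eq_univ_of_forall fun ⟨p, hp⟩ => ?_
  simp only [arrangement, Set.mem_iUnion₂] at hp
  obtain ⟨W, hW, hp⟩ := hp
  exact Set.mem_iUnion.2 ⟨⟨W, hW⟩, hp⟩

theorem topologicalKrullDim_arrangementPiece {W : Submodule ℂ (E → ℂ)} (hW : W ∈ 𝒲) :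
    topologicalKrullDim (arrangementPiece 𝒲 W) =
      topologicalKrullDim (W.projectivization : Set (CProj E)) := by
  rw [← image_arrangementPiece hW, topologicalKrullDim_image_eq IsEmbedding.subtypeVal]

theorem topologicalKrullDim_projectivization_bot :
    topologicalKrullDim ((⊥ : Submodule ℂ (E → ℂ)).projectivization : Set (CProj E)) = ⊥ := by
  have hempty : ¬((⊥ : Submodule ℂ (E → ℂ)).projectivization : Set (CProj E)).Nonempty :=
    fun h => projectivization_nonempty_iff.1 h rfl
  have : IsEmpty (IrreducibleCloseds
      ((⊥ : Submodule ℂ (E → ℂ)).projectivization : Set (CProj E))) :=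
    ⟨fun S => hempty (Set.nonempty_coe_sort.1 S.isIrreducible.nonempty.to_type)⟩
  exact Order.krullDim_eq_bot

variable [Finite E]

theorem isClosed_arrangementPiece (W : Submodule ℂ (E → ℂ)) : IsClosed (arrangementPiece 𝒲 W) :=
  (isClosed_projectivization W).preimage continuous_subtype_val

theorem isPreirreducible_arrangementPiece {W : Submodule ℂ (E → ℂ)} (hW : W ∈ 𝒲) :
    IsPreirreducible (arrangementPiece 𝒲 W) := by
  rcases (arrangementPiece 𝒲 W).eq_empty_or_nonempty with h | h
  · rw [h]
    exact isPreirreducible_empty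
  · refine (isIrreducible_of_isIrreducible_image IsInducing.subtypeVal
      ⟨h.image _, ?_⟩).isPreirreducible
    rw [image_arrangementPiece hW]
    exact isPreirreducible_projectivization W

theorem topologicalKrullDim_projectivization_eq_iff {W : Submodule ℂ (E → ℂ)} {r : ℕ} :
    topologicalKrullDim (W.projectivization : Set (CProj E)) = r ↔ Module.finrank ℂ W = r + 1 := by
  refine ⟨fun h => ?_, topologicalKrullDim_projectivization⟩
  cases hn : Module.finrank ℂ W with
  | zero =>
    rw [Submodule.finrank_eq_zero.1 hn, topologicalKrullDim_projectivization_bot] at h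
    exact absurd h WithBot.bot_ne_coe
  | succ s =>
    rw [topologicalKrullDim_projectivization hn] at h
    rw [Nat.cast_injective h]

theorem topologicalKrullDim_projectivization_le {W : Submodule ℂ (E → ℂ)} {r : ℕ}
    (h : Module.finrank ℂ W ≤ r + 1) :
    topologicalKrullDim (W.projectivization : Set (CProj E)) ≤ r := by
  cases hn : Module.finrank ℂ W with
  | zero =>
    rw [Submodule.finrank_eq_zero.1 hn, topologicalKrullDim_projectivization_bot]
    exact bot_le
  | succ s =>
    rw [topologicalKrullDim_projectivization hn]
    exact_mod_cast (by omega : s ≤ r)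

theorem hasDim_arrangement [Finite 𝒲] {n : ℕ} (hle : ∀ W ∈ 𝒲, Module.finrank ℂ W ≤ n)
    (hmax : ∃ W ∈ 𝒲, Module.finrank ℂ W = n) : HasDim (arrangement 𝒲) ((n : ℤ) - 1) := by
  cases n with
  | zero =>
    refine Or.inl ⟨Set.isEmpty_coe_sort.2 (Set.iUnion_eq_empty.2 fun W =>
      Set.iUnion_eq_empty.2 fun hW => ?_), rfl⟩
    rw [← Set.not_nonempty_iff_eq_empty, projectivization_nonempty_iff, not_not]
    exact Submodule.finrank_eq_zero.1 (Nat.le_zero.1 (hle W hW))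
  | succ r =>
    rw [Nat.cast_succ, add_sub_cancel_right, hasDim_natCast_iff]
    apply le_antisymm
    · refine topologicalKrullDim_le_of_iUnion_eq_univ
        (fun W : 𝒲 => isClosed_arrangementPiece W.1) iUnion_arrangementPiece fun W => ?_
      rw [topologicalKrullDim_arrangementPiece W.2]
      exact topologicalKrullDim_projectivization_le (hle W W.2)
    · obtain ⟨W, hW, hn⟩ := hmax
      rw [← topologicalKrullDim_projectivization hn, ← topologicalKrullDim_arrangementPiece hW]
      exact topologicalKrullDim_subspace_le _ _

theorem encard_irreducibleComponents_arrangement [Finite 𝒲] {n : ℕ} (hn : 1 ≤ n) :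
    {Z ∈ irreducibleComponents (arrangement 𝒲) | HasDim Z ((n : ℤ) - 1)}.encard =
      {W | Maximal (· ∈ 𝒲) W ∧ Module.finrank ℂ W = n}.encard := by
  obtain ⟨r, rfl⟩ := Nat.exists_eq_add_of_le' hn
  have hcomponents (Z : Set (arrangement 𝒲)) : Z ∈ irreducibleComponents (arrangement 𝒲) ↔
      Z.Nonempty ∧ Z ∈ arrangementPiece 𝒲 '' {W | Maximal (· ∈ 𝒲) W} := by
    rw [mem_irreducibleComponents_iff_maximal_mem_range
      (fun W : 𝒲 => isClosed_arrangementPiece W.1)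
      (fun W : 𝒲 => isPreirreducible_arrangementPiece W.2) iUnion_arrangementPiece,
      image_monotone_setOfPred_maximal fun W W' hW hW' => arrangementPiece_subset_iff hW hW',
      ← Set.image_eq_range]
    rfl
  have hinj : Set.InjOn (arrangementPiece 𝒲) 𝒲 := fun W hW W' hW' h =>
    le_antisymm ((arrangementPiece_subset_iff hW hW').1 h.subset)
      ((arrangementPiece_subset_iff hW' hW).1 h.superset)
  rw [← (hinj.mono fun W hW => hW.1.prop).encard_image]
  congr 1
  ext Z
  simp only [Set.mem_ofPred_eq, hcomponents, Set.mem_image, Nat.cast_succ, add_sub_cancel_right,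
    hasDim_natCast_iff]
  constructor
  · rintro ⟨⟨-, W, hW, rfl⟩, hdim⟩
    rw [topologicalKrullDim_arrangementPiece hW.prop,
      topologicalKrullDim_projectivization_eq_iff] at hdim
    exact ⟨W, ⟨hW, hdim⟩, rfl⟩
  · rintro ⟨W, ⟨hW, hdim⟩, rfl⟩
    refine ⟨⟨?_, W, hW, rfl⟩, ?_⟩
    · rw [← Set.image_nonempty (f := Subtype.val), image_arrangementPiece hW.prop,
        projectivization_nonempty_iff]
      rintro rfl
      simp at hdim
    · rw [topologicalKrullDim_arrangementPiece hW.prop]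
      exact topologicalKrullDim_projectivization hdim

end Arrangement

end CProj

/-! ### Existence of the Hilbert polynomial -/

section Monomials

variable {σ : Type*}

theorem ncard_setOf_degree_eq [Fintype σ] (t : ℕ) :
    {m : σ →₀ ℕ | m.degree = t}.ncard = (Fintype.card σ).multichoose t := by
  classical
  rw [← Finset.card_univ, ← Finset.card_finsuppAntidiag_nat_eq_multichoose, ← Set.ncard_coe_finset]
  congr 1
  ext m
  simp [Finset.mem_finsuppAntidiag, Finsupp.degree_eq_sum]

theorem multichoose_succ_eq_eval_preHilbertPoly (r t : ℕ) :
    ((r + 1).multichoose t : ℚ) = (Polynomial.preHilbertPoly ℚ r 0).eval (t : ℚ) := by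
  rw [Polynomial.preHilbertPoly_eq_choose_sub_add ℚ r (Nat.zero_le t), Nat.multichoose_eq,
    Nat.sub_zero, show r + 1 + t - 1 = t + r by lia, Nat.choose_symm_add]

theorem exists_eventually_multichoose_eq_eval (s : ℕ) :
    ∃ P : Polynomial ℚ, ∀ᶠ t : ℕ in atTop, (s.multichoose t : ℚ) = P.eval (t : ℚ) := by
  cases s with
  | zero =>
    refine ⟨0, (eventually_ge_atTop 1).mono fun t ht => ?_⟩
    obtain ⟨t, rfl⟩ := Nat.exists_eq_add_of_le' ht
    simp
  | succ r => exact ⟨_, Eventually.of_forall (multichoose_succ_eq_eval_preHilbertPoly r)⟩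

/-- The number of monomials of degree `t` that are divisible by none of the monomials in `l`. -/
noncomputable def standardCount (l : List (σ →₀ ℕ)) (t : ℕ) : ℕ :=
  {m : σ →₀ ℕ | m.degree = t ∧ ∀ g ∈ l, ¬g ≤ m}.ncard

theorem image_add_left_setOf_degree_eq_sub (g : σ →₀ ℕ) (l : List (σ →₀ ℕ)) {t : ℕ}
    (ht : g.degree ≤ t) :
    (g + ·) '' {m | m.degree = t - g.degree ∧ ∀ h ∈ l.map fun h => h - g, ¬h ≤ m} =
      {m | m.degree = t ∧ g ≤ m ∧ ∀ h ∈ l, ¬h ≤ m} := by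
  ext m
  simp only [Set.mem_image, Set.mem_ofPred_eq, List.forall_mem_map, tsub_le_iff_left]
  constructor
  · rintro ⟨k, ⟨hd, hl⟩, rfl⟩
    refine ⟨?_, le_self_add, hl⟩
    rw [map_add]
    lia
  · rintro ⟨hd, hg, hl⟩
    obtain ⟨k, rfl⟩ := exists_add_of_le hg
    refine ⟨k, ⟨?_, hl⟩, rfl⟩
    rw [map_add] at hd
    lia

theorem standardCount_cons [Finite σ] (g : σ →₀ ℕ) (l : List (σ →₀ ℕ)) {t : ℕ}
    (ht : g.degree ≤ t) :
    standardCount l t =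
      standardCount (g :: l) t + standardCount (l.map fun h => h - g) (t - g.degree) := by
  have hfin (p : (σ →₀ ℕ) → Prop) : {m : σ →₀ ℕ | m.degree = t ∧ p m}.Finite :=
    (Finsupp.finite_of_degree_eq t).subset fun m hm => hm.1
  have hsplit : {m : σ →₀ ℕ | m.degree = t ∧ ∀ g ∈ l, ¬g ≤ m} =
      {m : σ →₀ ℕ | m.degree = t ∧ ∀ h ∈ g :: l, ¬h ≤ m} ∪
        {m : σ →₀ ℕ | m.degree = t ∧ g ≤ m ∧ ∀ h ∈ l, ¬h ≤ m} := by
    ext m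
    simp only [Set.mem_union, Set.mem_ofPred_eq, List.forall_mem_cons]
    tauto
  have hdisj : Disjoint {m : σ →₀ ℕ | m.degree = t ∧ ∀ h ∈ g :: l, ¬h ≤ m}
      {m : σ →₀ ℕ | m.degree = t ∧ g ≤ m ∧ ∀ h ∈ l, ¬h ≤ m} :=
    Set.disjoint_left.2 fun m hm hm' => hm.2 g List.mem_cons_self hm'.2.1
  rw [standardCount, hsplit, Set.ncard_union_eq hdisj (hfin _) (hfin _),
    ← image_add_left_setOf_degree_eq_sub g l ht,
    Set.ncard_image_of_injective _ (add_right_injective g), standardCount, standardCount]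

theorem exists_eventually_standardCount_eq_eval [Finite σ] (l : List (σ →₀ ℕ)) :
    ∃ P : Polynomial ℚ, ∀ᶠ t : ℕ in atTop, (standardCount l t : ℚ) = P.eval (t : ℚ) := by
  have := Fintype.ofFinite σ
  induction hn : l.length generalizing l with
  | zero =>
    obtain rfl := List.length_eq_zero_iff.1 hn
    obtain ⟨P, hP⟩ := exists_eventually_multichoose_eq_eval (Fintype.card σ)
    refine ⟨P, hP.mono fun t ht => ?_⟩
    rw [← ht, ← ncard_setOf_degree_eq]
    simp [standardCount]
  | succ n ih =>
    obtain ⟨g, l, rfl⟩ := List.exists_cons_of_length_eq_add_one hn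
    obtain ⟨P, hP⟩ := ih l (by simpa using hn)
    obtain ⟨Q, hQ⟩ := ih (l.map fun h => h - g) (by simpa using hn)
    refine ⟨P - Q.comp (Polynomial.X - Polynomial.C (g.degree : ℚ)), ?_⟩
    filter_upwards [hP, (tendsto_sub_atTop_nat g.degree).eventually hQ,
      eventually_ge_atTop g.degree] with t hPt hQt ht
    rw [Polynomial.eval_sub, ← hPt, Polynomial.eval_comp, Polynomial.eval_sub, Polynomial.eval_X,
      Polynomial.eval_C, ← Nat.cast_sub ht, ← hQt, standardCount_cons g l ht]
    push_cast
    ring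

/-- By Dickson's lemma, an upper set of monomials is generated by finitely many monomials. -/
theorem exists_eventually_ncard_compl_eq_eval [Finite σ] {U : Set (σ →₀ ℕ)} (hU : IsUpperSet U) :
    ∃ P : Polynomial ℚ, ∀ᶠ t : ℕ in atTop,
      ({m : σ →₀ ℕ | m.degree = t ∧ m ∉ U}.ncard : ℚ) = P.eval (t : ℚ) := by
  have hfin : {m | Minimal (· ∈ U) m}.Finite :=
    WellQuasiOrderedLE.finite_of_isAntichain (setOfPred_minimal_antichain (· ∈ U))
  obtain ⟨P, hP⟩ := exists_eventually_standardCount_eq_eval hfin.toFinset.toList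
  refine ⟨P, hP.mono fun t ht => ?_⟩
  rw [← ht, standardCount]
  congr 2
  ext m
  simp only [Set.mem_ofPred_eq, Finset.mem_toList, Set.Finite.mem_toFinset]
  refine and_congr_right fun _ => ⟨fun hm g hg hgm => hm (hU hgm hg.prop), fun h hm => ?_⟩
  obtain ⟨g, hgm, hg⟩ := exists_minimal_le_of_wellFoundedLT (· ∈ U) m hm
  exact h g hg hgm

end Monomials

section InitialMonomials

variable {σ K : Type*} [Field K]

theorem degree_eq_of_mem_support {f : MvPolynomial σ K} {t : ℕ} (hf : f.IsHomogeneous t)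
    {m : σ →₀ ℕ} (hm : m ∈ f.support) : m.degree = t :=
  (hf.degree_eq_sum_deg_support hm).symm

/-- The leading monomials of the forms in an ideal. -/
def initialMonomials (ord : MonomialOrder σ) (I : Ideal (MvPolynomial σ K)) : Set (σ →₀ ℕ) :=
  {m | ∃ f ∈ I, f ≠ 0 ∧ f.IsHomogeneous m.degree ∧ ord.degree f = m}

theorem isUpperSet_initialMonomials (ord : MonomialOrder σ) (I : Ideal (MvPolynomial σ K)) :
    IsUpperSet (initialMonomials ord I) := by
  classical
  rintro m n hmn ⟨f, hf, hf0, hfh, rfl⟩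
  obtain ⟨k, rfl⟩ := exists_add_of_le hmn
  have hk : monomial k (1 : K) ≠ 0 := by simp
  refine ⟨f * monomial k 1, I.mul_mem_right _ hf, mul_ne_zero hf0 hk, ?_, ?_⟩
  · rw [map_add]
    exact hfh.mul (isHomogeneous_monomial 1 rfl)
  · rw [ord.degree_mul hf0 hk, ord.degree_monomial, if_neg one_ne_zero]

/-- The monomials of degree `t` which are not leading monomials of forms in an ideal `I`: they
form a basis of the degree `t` part of the quotient by `I`. -/
def standardMonomials (ord : MonomialOrder σ) (I : Ideal (MvPolynomial σ K)) (t : ℕ) :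
    Set (σ →₀ ℕ) :=
  {m | m.degree = t ∧ m ∉ initialMonomials ord I}

variable (ord : MonomialOrder σ) (I : Ideal (MvPolynomial σ K)) (t : ℕ)

theorem restrictSupport_standardMonomials_le :
    restrictSupport K (standardMonomials ord I t) ≤ homogeneousSubmodule σ K t := by
  rw [restrictSupport_eq_span, Submodule.span_le]
  rintro _ ⟨m, hm, rfl⟩
  exact isHomogeneous_monomial 1 hm.1

theorem monomial_mem_restrictSupport_standardMonomials_sup {m : σ →₀ ℕ} (hm : m.degree = t)
    (c : K) :
    monomial m c ∈ restrictSupport K (standardMonomials ord I t) ⊔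
      (I.restrictScalars K ⊓ homogeneousSubmodule σ K t) := by
  classical
  induction hs : ord.toSyn m using WellFoundedLT.induction generalizing m c with
  | ind s ih =>
  by_cases hmI : m ∈ initialMonomials ord I
  · obtain ⟨f, hf, hf0, hfh, hfm⟩ := hmI
    rw [hm] at hfh
    have hmf : m ∈ f.support := hfm ▸ ord.degree_mem_support hf0
    have hlead : monomial m (coeff m f) =
        f - ∑ k ∈ f.support.erase m, monomial k (coeff k f) := by
      rw [eq_sub_iff_add_eq, Finset.add_sum_erase _ (fun k => monomial k (coeff k f)) hmf]
      exact f.support_sum_monomial_coeff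
    have hc : monomial m c = (c / coeff m f) • monomial m (coeff m f) := by
      rw [smul_monomial, smul_eq_mul, div_mul_cancel₀ _ (mem_support_iff.1 hmf)]
    rw [hc, hlead]
    refine Submodule.smul_mem _ _ (Submodule.sub_mem _ (Submodule.mem_sup_right ⟨hf, hfh⟩)
      (Submodule.sum_mem _ fun k hk => ?_))
    obtain ⟨hkm, hkf⟩ := Finset.mem_erase.1 hk
    have hlt : ord.toSyn k < s := by
      rw [← hs, ← hfm]
      exact lt_of_le_of_ne (ord.le_degree hkf) fun h => hkm ((ord.toSyn.injective h).trans hfm)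
    exact ih _ hlt (degree_eq_of_mem_support hfh hkf) _ rfl
  · exact Submodule.mem_sup_left ((monomial_mem_restrictSupport K).2 (Or.inl ⟨hm, hmI⟩))

theorem isCompl_submoduleOf_restrictSupport_standardMonomials :
    IsCompl ((I.restrictScalars K).submoduleOf (homogeneousSubmodule σ K t))
      ((restrictSupport K (standardMonomials ord I t)).submoduleOf
        (homogeneousSubmodule σ K t)) := by
  constructor
  · rw [Submodule.disjoint_def]
    rintro ⟨f, hfH⟩ (hfI : f ∈ I) (hfS : f ∈ restrictSupport K (standardMonomials ord I t))
    by_contra hne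
    have hf0 : f ≠ 0 := fun h => hne (Subtype.ext h)
    have hmem := ord.degree_mem_support hf0
    refine ((mem_restrictSupport_iff K).1 hfS hmem).2 ⟨f, hfI, hf0, ?_, rfl⟩
    rwa [degree_eq_of_mem_support hfH hmem]
  · rw [codisjoint_iff, eq_top_iff]
    rintro ⟨f, hfH⟩ -
    have hf : f ∈ restrictSupport K (standardMonomials ord I t) ⊔
        (I.restrictScalars K ⊓ homogeneousSubmodule σ K t) := by
      rw [← f.support_sum_monomial_coeff]
      exact Submodule.sum_mem _ fun m hm => monomial_mem_restrictSupport_standardMonomials_sup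
        ord I t (degree_eq_of_mem_support hfH hm) _
    obtain ⟨a, ha, b, hb, rfl⟩ := Submodule.mem_sup.1 hf
    exact Submodule.mem_sup.2 ⟨⟨b, hb.2⟩, hb.1,
      ⟨a, restrictSupport_standardMonomials_le ord I t ha⟩, ha, Subtype.ext (add_comm b a)⟩

theorem finrank_quotient_submoduleOf_homogeneousSubmodule :
    Module.finrank K (homogeneousSubmodule σ K t ⧸
      (I.restrictScalars K).submoduleOf (homogeneousSubmodule σ K t)) =
      (standardMonomials ord I t).ncard := by
  rw [(Submodule.quotientEquivOfIsCompl _ _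
      (isCompl_submoduleOf_restrictSupport_standardMonomials ord I t)).finrank_eq,
    (Submodule.submoduleOfEquivOfLe (restrictSupport_standardMonomials_le ord I t)).finrank_eq,
    Module.finrank_eq_nat_card_basis (basisRestrictSupport K _), Nat.card_coe_set_eq]

end InitialMonomials

theorem CProj.exists_eventually_hilbertFunction_eq_eval {E : Type*} [Finite E]
    (X : Set (CProj E)) :
    ∃ P : Polynomial ℚ, ∀ᶠ t : ℕ in atTop, (hilbertFunction X t : ℚ) = P.eval (t : ℚ) := by
  let : LinearOrder E := LinearOrder.lift' (Finite.equivFin E) (Finite.equivFin E).injective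
  obtain ⟨P, hP⟩ := exists_eventually_ncard_compl_eq_eval
    (isUpperSet_initialMonomials MonomialOrder.lex (vanishingIdeal X))
  refine ⟨P, hP.mono fun t ht => ?_⟩
  rw [← ht, hilbertFunction, finrank_quotient_submoduleOf_homogeneousSubmodule MonomialOrder.lex,
    standardMonomials]

section Asymptotics

theorem natDegree_eq_and_leadingCoeff_eq_of_tendsto {P : Polynomial ℚ} {r : ℕ} {c : ℚ}
    (hc : c ≠ 0) (h : Tendsto (fun t : ℕ => P.eval (t : ℚ) / (t : ℚ) ^ r) atTop (𝓝 c)) :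
    P.natDegree = r ∧ P.leadingCoeff = c := by
  have hX (t : ℕ) : P.eval (t : ℚ) / (t : ℚ) ^ r =
      P.eval (t : ℚ) / (Polynomial.X ^ r : Polynomial ℚ).eval (t : ℚ) := by simp
  simp only [hX] at h
  have hcast : Tendsto (fun t : ℕ => (t : ℚ)) atTop atTop := tendsto_natCast_atTop_atTop
  rcases lt_trichotomy P.degree (Polynomial.X ^ r : Polynomial ℚ).degree with hlt | heq | hgt
  · exact absurd (tendsto_nhds_unique h
      ((P.div_tendsto_atTop_zero_of_degree_lt _ hlt).comp hcast)) hc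
  · refine ⟨by rw [Polynomial.natDegree_eq_natDegree heq, Polynomial.natDegree_X_pow], ?_⟩
    have hlim := tendsto_nhds_unique h
      ((P.div_tendsto_atTop_leadingCoeff_div_of_degree_eq _ heq).comp hcast)
    simpa using hlim.symm
  · exact absurd h.abs (not_tendsto_nhds_of_tendsto_atTop
      ((P.abs_div_tendsto_atTop_atTop_of_degree_gt _ hgt
        (pow_ne_zero _ Polynomial.X_ne_zero)).comp hcast) _)

theorem tendsto_eval_preHilbertPoly_div_pow (r k : ℕ) :
    Tendsto (fun t : ℕ => (Polynomial.preHilbertPoly ℚ r k).eval (t : ℚ) / (t : ℚ) ^ r) atTop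
      (𝓝 (r.factorial : ℚ)⁻¹) := by
  have hne : Polynomial.preHilbertPoly ℚ r k ≠ 0 := by
    rw [← Polynomial.leadingCoeff_ne_zero, Polynomial.leadingCoeff_preHilbertPoly]
    exact inv_ne_zero (Nat.cast_ne_zero.2 r.factorial_ne_zero)
  have hdeg : (Polynomial.preHilbertPoly ℚ r k).degree =
      (Polynomial.X ^ r : Polynomial ℚ).degree := by
    rw [Polynomial.degree_eq_natDegree hne, Polynomial.natDegree_preHilbertPoly,
      Polynomial.degree_X_pow]
  have h := (Polynomial.div_tendsto_atTop_leadingCoeff_div_of_degree_eq _ _ hdeg).comp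
    (tendsto_natCast_atTop_atTop (R := ℚ))
  simpa [Function.comp_def, Polynomial.leadingCoeff_preHilbertPoly] using h

theorem tendsto_multichoose_sub_div_pow (r k : ℕ) :
    Tendsto (fun t : ℕ => ((r + 1).multichoose (t - k) : ℚ) / (t : ℚ) ^ r) atTop
      (𝓝 (r.factorial : ℚ)⁻¹) := by
  refine (tendsto_eval_preHilbertPoly_div_pow r k).congr' ?_
  filter_upwards [eventually_ge_atTop k] with t ht
  rw [Polynomial.preHilbertPoly_eq_choose_sub_add ℚ r ht, Nat.multichoose_eq,
    show r + 1 + (t - k) - 1 = t - k + r by lia, Nat.choose_symm_add]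

theorem tendsto_multichoose_div_pow_of_le {s r : ℕ} (h : s ≤ r) :
    Tendsto (fun t : ℕ => (s.multichoose t : ℚ) / (t : ℚ) ^ r) atTop (𝓝 0) := by
  cases s with
  | zero =>
    refine tendsto_const_nhds.congr' ?_
    filter_upwards [eventually_ge_atTop 1] with t ht
    obtain ⟨t, rfl⟩ := Nat.exists_eq_add_of_le' ht
    simp
  | succ s =>
    have hlim := (tendsto_multichoose_sub_div_pow s 0).mul
      (((tendsto_pow_atTop (α := ℚ) (n := r - s) (by lia)).comp
        tendsto_natCast_atTop_atTop).inv_tendsto_atTop)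
    rw [mul_zero] at hlim
    refine hlim.congr fun t => ?_
    rw [Nat.sub_zero, Pi.inv_apply, Function.comp_apply, ← div_eq_mul_inv, div_div, ← pow_add,
      Nat.add_sub_cancel' (by lia)]

end Asymptotics

/-! ### Hilbert functions of unions and of linear subspaces -/

theorem finrank_quotient_le_of_ker_le {K M N : Type*} [Field K] [AddCommGroup M] [Module K M]
    [AddCommGroup N] [Module K N] [Module.Finite K N] {φ : M →ₗ[K] N} {p : Submodule K M}
    (h : LinearMap.ker φ ≤ p) : Module.finrank K (M ⧸ p) ≤ Module.finrank K N := by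
  have : Module.Finite K (M ⧸ LinearMap.ker φ) := Module.Finite.equiv φ.quotKerEquivRange.symm
  calc Module.finrank K (M ⧸ p) ≤ Module.finrank K (M ⧸ LinearMap.ker φ) :=
        LinearMap.finrank_le_finrank_of_surjective (Submodule.factor_surjective h)
    _ = Module.finrank K (LinearMap.range φ) := φ.quotKerEquivRange.finrank_eq
    _ ≤ Module.finrank K N := Submodule.finrank_le _

theorem finrank_quotient_le_sum_of_iInf_le {K M ι : Type*} [Field K] [AddCommGroup M] [Module K M]
    [Module.Finite K M] [Fintype ι] {p : Submodule K M} {q : ι → Submodule K M}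
    (h : ⨅ i, q i ≤ p) : Module.finrank K (M ⧸ p) ≤ ∑ i, Module.finrank K (M ⧸ q i) := by
  rw [← Module.finrank_pi_fintype]
  refine finrank_quotient_le_of_ker_le (φ := LinearMap.pi fun i => (q i).mkQ) ?_
  simpa only [LinearMap.ker_pi, Submodule.ker_mkQ] using h

theorem finrank_quotient_pi {K ι : Type*} {M : ι → Type*} [Field K] [∀ i, AddCommGroup (M i)]
    [∀ i, Module K (M i)] [∀ i, Module.Finite K (M i)] [Fintype ι] (p : ∀ i, Submodule K (M i)) :
    Module.finrank K ((∀ i, M i) ⧸ Submodule.pi Set.univ p) =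
      ∑ i, Module.finrank K (M i ⧸ p i) := by
  classical
  rw [(Submodule.quotientPi p).finrank_eq, Module.finrank_pi_fintype]

theorem finrank_quotient_comap_of_surjective {K M N : Type*} [Field K] [AddCommGroup M]
    [Module K M] [AddCommGroup N] [Module K N] {φ : M →ₗ[K] N} (hφ : Function.Surjective φ)
    (q : Submodule K N) : Module.finrank K (M ⧸ q.comap φ) = Module.finrank K (N ⧸ q) := by
  have hker : q.comap φ = LinearMap.ker (q.mkQ ∘ₗ φ) := by
    rw [LinearMap.ker_comp, Submodule.ker_mkQ]
  rw [hker]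
  exact ((q.mkQ ∘ₗ φ).quotKerEquivOfSurjective (q.mkQ_surjective.comp hφ)).finrank_eq

instance finite_homogeneousSubmodule {σ K : Type*} [Finite σ] [CommSemiring K] (t : ℕ) :
    Module.Finite K (homogeneousSubmodule σ K t) :=
  Module.Finite.iff_fg.2 (homogeneousSubmodule_fg σ K t)

theorem finrank_homogeneousSubmodule {σ K : Type*} [Fintype σ] [Field K] (t : ℕ) :
    Module.finrank K (homogeneousSubmodule σ K t) = (Fintype.card σ).multichoose t := by
  rw [homogeneousSubmodule_eq_finsupp_supported, ← ncard_setOf_degree_eq, ← Nat.card_coe_set_eq]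
  exact Module.finrank_eq_nat_card_basis (basisRestrictSupport K _)

namespace CProj

section HilbertFunction

variable {E : Type*} {X Z : Set (CProj E)}

/-- The forms of degree `t` which vanish on `X`, as a subspace of the space of all forms. -/
noncomputable def vanishingForms (X : Set (CProj E)) (t : ℕ) :
    Submodule ℂ (homogeneousSubmodule E ℂ t) :=
  ((vanishingIdeal X).restrictScalars ℂ).submoduleOf (homogeneousSubmodule E ℂ t)

theorem mem_vanishingForms_iff {t : ℕ} {f : homogeneousSubmodule E ℂ t} :
    f ∈ vanishingForms X t ↔ (f : MvPolynomial E ℂ) ∈ vanishingIdeal X :=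
  Iff.rfl

theorem hilbertFunction_eq_finrank (X : Set (CProj E)) (t : ℕ) :
    hilbertFunction X t = Module.finrank ℂ (homogeneousSubmodule E ℂ t ⧸ vanishingForms X t) :=
  rfl

theorem mem_vanishingIdeal_iUnion_iff {ι : Type*} {Z : ι → Set (CProj E)} {f : MvPolynomial E ℂ} :
    f ∈ vanishingIdeal (⋃ i, Z i) ↔ ∀ i, f ∈ vanishingIdeal (Z i) :=
  ⟨fun h i => vanishingIdeal_anti (Set.subset_iUnion Z i) h, fun h p hp => by
    obtain ⟨i, hi⟩ := Set.mem_iUnion.1 hp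
    exact h i p hi⟩

theorem hilbertFunction_iUnion_le [Finite E] {ι : Type*} [Fintype ι] (Z : ι → Set (CProj E))
    (t : ℕ) : hilbertFunction (⋃ i, Z i) t ≤ ∑ i, hilbertFunction (Z i) t :=
  finrank_quotient_le_sum_of_iInf_le fun _ hf => mem_vanishingIdeal_iUnion_iff.2 fun i =>
    mem_vanishingForms_iff.1 ((Submodule.mem_iInf _).1 hf i)

/-- A sum `∑ gᵢ fᵢ` which vanishes on `X` vanishes on each `Zⱼ`, where only the summand `gⱼ fⱼ`
survives; since the ideal of `Zⱼ` is prime, `fⱼ` vanishes on `Zⱼ`. -/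
theorem sum_hilbertFunction_le [Finite E] {ι : Type*} [Fintype ι] {Z : ι → Set (CProj E)}
    (hZ : ∀ i, IsIrreducible (Z i)) (hZX : ∀ i, Z i ⊆ X) {g : ι → MvPolynomial E ℂ} {n : ι → ℕ}
    (hg : ∀ i, (g i).IsHomogeneous (n i)) (hgi : ∀ i, g i ∉ vanishingIdeal (Z i))
    (hgj : ∀ i j, i ≠ j → g i ∈ vanishingIdeal (Z j)) {t : ℕ} {s : ι → ℕ}
    (hs : ∀ i, n i + s i = t) :
    ∑ i, hilbertFunction (Z i) (s i) ≤ hilbertFunction X t := by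
  have hmul (i : ι) (f : MvPolynomial E ℂ) (hf : f ∈ homogeneousSubmodule E ℂ (s i)) :
      LinearMap.mulLeft ℂ (g i) f ∈ homogeneousSubmodule E ℂ t := hs i ▸ (hg i).mul hf
  let φ : (∀ i, homogeneousSubmodule E ℂ (s i)) →ₗ[ℂ]
      homogeneousSubmodule E ℂ t ⧸ vanishingForms X t :=
    (vanishingForms X t).mkQ ∘ₗ
      ∑ i, (LinearMap.mulLeft ℂ (g i)).restrict (hmul i) ∘ₗ LinearMap.proj i
  have hφ : LinearMap.ker φ ≤ Submodule.pi Set.univ fun i => vanishingForms (Z i) (s i) := by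
    intro f hf j _
    have hsum : ∑ i, g i * f i ∈ vanishingIdeal (Z j) := by
      have h := mem_vanishingForms_iff.1 ((Submodule.Quotient.mk_eq_zero _).1 hf)
      refine vanishingIdeal_anti (hZX j) ?_
      simpa using h
    have hterm : g j * f j ∈ vanishingIdeal (Z j) := by
      classical
      rw [← Finset.add_sum_erase _ _ (Finset.mem_univ j)] at hsum
      refine (Ideal.add_mem_iff_left _ (Ideal.sum_mem _ fun i hi => ?_)).1 hsum
      exact Ideal.mul_mem_right _ _ (hgj i j (Finset.ne_of_mem_erase hi))
    exact ((isPrime_vanishingIdeal (hZ j)).mem_or_mem hterm).resolve_left (hgi j)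
  exact (finrank_quotient_pi _).symm.le.trans (finrank_quotient_le_of_ker_le hφ)

theorem exists_isHomogeneous_mem_vanishingIdeal_notMem {Y : Set (CProj E)} (hY : IsClosed Y)
    (h : ¬Z ⊆ Y) :
    ∃ (n : ℕ) (g : MvPolynomial E ℂ), g.IsHomogeneous n ∧ g ∈ vanishingIdeal Y ∧
      g ∉ vanishingIdeal Z := by
  obtain ⟨p, hpZ, hpY⟩ := Set.not_subset.1 h
  rw [← isClosed_iff_zeroLocus_vanishingIdeal.1 hY] at hpY
  obtain ⟨f, hfY, hfp⟩ : ∃ f ∈ vanishingIdeal Y, ¬Vanishes f p := by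
    simpa [zeroLocus] using hpY
  obtain ⟨n, hn⟩ : ∃ n, ¬Vanishes (homogeneousComponent n f) p := by
    rwa [vanishes_iff_forall_homogeneousComponent, not_forall] at hfp
  exact ⟨n, homogeneousComponent n f, homogeneousComponent_isHomogeneous n f,
    mem_vanishingIdeal_iff_forall_homogeneousComponent.1 hfY n, fun hZ => hn (hZ p hpZ)⟩

theorem exists_forall_sum_hilbertFunction_le [Finite E] {ι : Type*} [Fintype ι]
    {Z : ι → Set (CProj E)} (hirr : ∀ i, IsIrreducible (Z i)) (hcl : ∀ i, IsClosed (Z i))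
    (hZ : ∀ i j, i ≠ j → ¬Z i ⊆ Z j) (hZX : ∀ i, Z i ⊆ X) :
    ∃ n : ι → ℕ, ∀ (t : ℕ) (s : ι → ℕ), (∀ i, n i + s i = t) →
      ∑ i, hilbertFunction (Z i) (s i) ≤ hilbertFunction X t := by
  have hsep (i : ι) : ¬Z i ⊆ ⋃ j : {j // i ≠ j}, Z j := fun h =>
    let ⟨j, hj⟩ := exists_subset_of_subset_iUnion (fun j : {j // i ≠ j} => hcl j) (hirr i) h
    hZ i j j.2 hj
  choose n g hg hgj hgi using fun i => exists_isHomogeneous_mem_vanishingIdeal_notMem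
    (isClosed_iUnion_of_finite fun j : {j // i ≠ j} => hcl j) (hsep i)
  exact ⟨n, fun t s hs => sum_hilbertFunction_le hirr hZX hg hgi
    (fun i j hij => mem_vanishingIdeal_iUnion_iff.1 (hgj i) ⟨j, hij⟩) hs⟩

theorem hilbertFunction_le_multichoose [Fintype E] (X : Set (CProj E)) (t : ℕ) :
    hilbertFunction X t ≤ (Fintype.card E).multichoose t := by
  rw [hilbertFunction_eq_finrank, ← finrank_homogeneousSubmodule (K := ℂ)]
  exact Submodule.finrank_quotient_le _

theorem hilbertFunction_univ [Fintype E] [Nonempty E] (t : ℕ) :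
    hilbertFunction (Set.univ : Set (CProj E)) t = (Fintype.card E).multichoose t := by
  have h : vanishingForms (Set.univ : Set (CProj E)) t = ⊥ := by
    ext f
    rw [mem_vanishingForms_iff, vanishingIdeal_univ, Ideal.mem_bot, Submodule.mem_bot,
      ZeroMemClass.coe_eq_zero]
  rw [hilbertFunction_eq_finrank, h, (Submodule.quotEquivOfEqBot _ rfl).finrank_eq,
    finrank_homogeneousSubmodule]

variable {σ : Type*}

theorem pullback_pullback [Fintype σ] [Fintype E] {A : (σ → ℂ) →ₗ[ℂ] (E → ℂ)}
    {B : (E → ℂ) →ₗ[ℂ] (σ → ℂ)} (hBA : B ∘ₗ A = LinearMap.id) (g : MvPolynomial σ ℂ) :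
    pullback A (pullback B g) = g :=
  MvPolynomial.funext fun y => by
    have h : B (A y) = y := LinearMap.congr_fun hBA y
    simp only [← coe_aeval_eq_eval, RingHom.coe_coe, aeval_pullback, h]

theorem mem_vanishingIdeal_range_map_iff [Fintype σ] {A : (σ → ℂ) →ₗ[ℂ] (E → ℂ)}
    (hA : Function.Injective A) {f : MvPolynomial E ℂ} :
    f ∈ vanishingIdeal (Set.range (Projectivization.map A hA)) ↔
      pullback A f ∈ vanishingIdeal Set.univ := by
  refine Set.forall_mem_range.trans ⟨fun h p _ => ?_, fun h p => ?_⟩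
  · exact (vanishes_pullback_iff hA f p).2 (h p)
  · exact (vanishes_pullback_iff hA f p).1 (h p (Set.mem_univ p))

theorem hilbertFunction_range_map [Finite σ] [Finite E] {A : (σ → ℂ) →ₗ[ℂ] (E → ℂ)}
    (hA : Function.Injective A) (t : ℕ) :
    hilbertFunction (Set.range (Projectivization.map A hA)) t =
      hilbertFunction (Set.univ : Set (CProj σ)) t := by
  cases nonempty_fintype σ
  cases nonempty_fintype E
  obtain ⟨B, hBA⟩ := A.exists_leftInverse_of_injective (LinearMap.ker_eq_bot.2 hA)
  let φ : homogeneousSubmodule E ℂ t →ₗ[ℂ] homogeneousSubmodule σ ℂ t :=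
    (pullback A).toLinearMap.restrict fun _ hf => isHomogeneous_pullback A hf
  have hφ : Function.Surjective φ := fun g =>
    ⟨⟨pullback B g, isHomogeneous_pullback B g.2⟩, Subtype.ext (pullback_pullback hBA g)⟩
  have hcomap : vanishingForms (Set.range (Projectivization.map A hA)) t =
      (vanishingForms Set.univ t).comap φ :=
    Submodule.ext fun _ => mem_vanishingIdeal_range_map_iff hA
  rw [hilbertFunction_eq_finrank, hilbertFunction_eq_finrank, hcomap,
    finrank_quotient_comap_of_surjective hφ]

variable [Finite E] (W : Submodule ℂ (E → ℂ)) (t : ℕ)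

theorem hilbertFunction_projectivization_eq_hilbertFunction_univ :
    hilbertFunction (W.projectivization : Set (CProj E)) t =
      hilbertFunction (Set.univ : Set (CProj (Fin (Module.finrank ℂ W)))) t := by
  obtain ⟨A, hA, hAW⟩ := exists_injective_range_eq W
  rw [← hilbertFunction_range_map hA, range_map, hAW]

theorem hilbertFunction_projectivization_le :
    hilbertFunction (W.projectivization : Set (CProj E)) t ≤
      (Module.finrank ℂ W).multichoose t := by
  rw [hilbertFunction_projectivization_eq_hilbertFunction_univ]
  exact (hilbertFunction_le_multichoose _ t).trans_eq (by rw [Fintype.card_fin])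

variable {W} in
theorem hilbertFunction_projectivization (hW : W ≠ ⊥) :
    hilbertFunction (W.projectivization : Set (CProj E)) t =
      (Module.finrank ℂ W).multichoose t := by
  have : NeZero (Module.finrank ℂ W) := ⟨(Submodule.finrank_eq_zero (S := W)).not.2 hW⟩
  rw [hilbertFunction_projectivization_eq_hilbertFunction_univ, hilbertFunction_univ,
    Fintype.card_fin]

end HilbertFunction

/-! ### The degree of an arrangement of linear subspaces -/

section DegreeArrangement

variable {E : Type*} [Finite E] {𝒲 : Set (Submodule ℂ (E → ℂ))} {r : ℕ}

theorem hilbertFunction_arrangement_le [Fintype 𝒲] (t : ℕ) :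
    hilbertFunction (arrangement 𝒲) t ≤
      ∑ W : 𝒲, (Module.finrank ℂ (W : Submodule ℂ (E → ℂ))).multichoose t := by
  rw [arrangement, Set.biUnion_eq_iUnion]
  exact (hilbertFunction_iUnion_le _ t).trans
    (Finset.sum_le_sum fun W _ => hilbertFunction_projectivization_le W.1 t)

theorem isIrreducible_projectivization {W : Submodule ℂ (E → ℂ)} (hW : W ≠ ⊥) :
    IsIrreducible (W.projectivization : Set (CProj E)) :=
  ⟨projectivization_nonempty_iff.2 hW, isPreirreducible_projectivization W⟩

theorem exists_eventually_sum_multichoose_le_hilbertFunction_arrangement {ι : Type*} [Fintype ι]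
    {W : ι → Submodule ℂ (E → ℂ)} (hinj : Function.Injective W) (hW : ∀ i, W i ∈ 𝒲)
    (hr : ∀ i, Module.finrank ℂ (W i) = r + 1) :
    ∃ n : ι → ℕ, ∀ᶠ t in atTop,
      ∑ i, (r + 1).multichoose (t - n i) ≤ hilbertFunction (arrangement 𝒲) t := by
  have hbot (i : ι) : W i ≠ ⊥ := fun h => by
    have h0 := hr i
    rw [h, finrank_bot] at h0
    lia
  have hle (i j : ι) (hij : i ≠ j) :
      ¬((W i).projectivization : Set (CProj E)) ⊆ (W j).projectivization := by
    rw [SetLike.coe_subset_coe, OrderIso.le_iff_le]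
    exact fun h => hij (hinj (Submodule.eq_of_le_of_finrank_eq h ((hr i).trans (hr j).symm)))
  obtain ⟨n, hn⟩ := exists_forall_sum_hilbertFunction_le
    (fun i => isIrreducible_projectivization (hbot i)) (fun i => isClosed_projectivization (W i))
    hle (fun i => projectivization_subset_arrangement (hW i))
  refine ⟨n, (eventually_all.2 fun i => eventually_ge_atTop (n i)).mono fun t ht => ?_⟩
  have h := hn t (fun i => t - n i) fun i => Nat.add_sub_cancel' (ht i)
  simpa only [hilbertFunction_projectivization _ (hbot _), hr] using h

theorem tendsto_hilbertFunction_arrangement_div_pow [Finite 𝒲]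
    (hle : ∀ W ∈ 𝒲, Module.finrank ℂ W ≤ r + 1) :
    Tendsto (fun t : ℕ => (hilbertFunction (arrangement 𝒲) t : ℚ) / (t : ℚ) ^ r) atTop
      (𝓝 ({W ∈ 𝒲 | Module.finrank ℂ W = r + 1}.ncard * (r.factorial : ℚ)⁻¹)) := by
  classical
  have := Fintype.ofFinite 𝒲
  let top := {W : 𝒲 // Module.finrank ℂ (W : Submodule ℂ (E → ℂ)) = r + 1}
  have hcard : {W ∈ 𝒲 | Module.finrank ℂ W = r + 1}.ncard = Fintype.card top := by
    rw [← Nat.card_coe_set_eq, ← Nat.card_eq_fintype_card]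
    exact Nat.card_congr (Equiv.subtypeSubtypeEquivSubtypeInter _ _).symm
  obtain ⟨n, hn⟩ := exists_eventually_sum_multichoose_le_hilbertFunction_arrangement
    (W := fun W : top => W.1.1) (Subtype.val_injective.comp Subtype.val_injective)
    (fun W => W.1.2) (fun W => W.2)
  have hlow : Tendsto (fun t : ℕ => ∑ W : top, ((r + 1).multichoose (t - n W) : ℚ) / (t : ℚ) ^ r)
      atTop (𝓝 (∑ _W : top, (r.factorial : ℚ)⁻¹)) :=
    tendsto_finsetSum _ fun W _ => tendsto_multichoose_sub_div_pow r (n W)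
  have hup : Tendsto
      (fun t : ℕ => ∑ W : 𝒲, ((Module.finrank ℂ W.1).multichoose t : ℚ) / (t : ℚ) ^ r) atTop
      (𝓝 (∑ W : 𝒲, if Module.finrank ℂ W.1 = r + 1 then (r.factorial : ℚ)⁻¹ else 0)) := by
    refine tendsto_finsetSum _ fun W _ => ?_
    split_ifs with h
    · rw [h]
      exact tendsto_multichoose_sub_div_pow r 0
    · exact tendsto_multichoose_div_pow_of_le (by have := hle W W.2; lia)
  rw [Finset.sum_const, nsmul_eq_mul, Finset.card_univ, ← hcard] at hlow
  rw [← Finset.sum_filter, Finset.sum_const, nsmul_eq_mul, ← Fintype.card_subtype, ← hcard] at hup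
  refine tendsto_of_tendsto_of_tendsto_of_le_of_le' hlow hup ?_ (Eventually.of_forall fun t => ?_)
  · filter_upwards [hn] with t ht
    rw [← Finset.sum_div]
    gcongr
    exact_mod_cast ht
  · rw [← Finset.sum_div]
    gcongr
    exact_mod_cast hilbertFunction_arrangement_le t

theorem hasDegree_arrangement [Finite 𝒲] (hle : ∀ W ∈ 𝒲, Module.finrank ℂ W ≤ r + 1)
    (hmax : ∃ W ∈ 𝒲, Module.finrank ℂ W = r + 1) :
    HasDegree (arrangement 𝒲) {W ∈ 𝒲 | Module.finrank ℂ W = r + 1}.ncard := by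
  obtain ⟨P, hP⟩ := exists_eventually_hilbertFunction_eq_eval (arrangement 𝒲)
  have hfac : (r.factorial : ℚ) ≠ 0 := Nat.cast_ne_zero.2 r.factorial_ne_zero
  have hcard : {W ∈ 𝒲 | Module.finrank ℂ W = r + 1}.ncard ≠ 0 :=
    ((Set.ncard_pos ((Set.toFinite 𝒲).subset (Set.sep_subset _ _))).2 hmax).ne'
  obtain ⟨hdeg, hlead⟩ := natDegree_eq_and_leadingCoeff_eq_of_tendsto
    (mul_ne_zero (Nat.cast_ne_zero.2 hcard) (inv_ne_zero hfac))
    ((tendsto_hilbertFunction_arrangement_div_pow hle).congr' (hP.mono fun t ht => by rw [ht]))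
  refine ⟨P, hP, ?_⟩
  rw [hdeg, hlead, mul_comm, mul_assoc, inv_mul_cancel₀ hfac, mul_one]

end DegreeArrangement

end CProj

/-! ### Cyclic sequences -/

section CyclicSequence

variable {α β : Type*} {r : α → α → Prop}

theorem exists_cycle_eq_coe_cons {c : Cycle α} {x : α} (hx : x ∈ c) :
    ∃ l : List α, c = ((x :: l : List α) : Cycle α) := by
  induction c using Quotient.inductionOn with
  | h l =>
    obtain ⟨s, t, rfl⟩ := List.append_of_mem (Cycle.mem_coe_iff.1 hx)
    exact ⟨t ++ s, Cycle.coe_eq_coe.2 (List.isRotated_append (l := s) (l' := x :: t))⟩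

theorem cycle_chain_imp_of_mem {s : α → α → Prop} {c : Cycle α} (hc : c.Chain r)
    (h : ∀ x ∈ c, ∀ y ∈ c, r x y → s x y) : c.Chain s := by
  induction c using Cycle.induction_on with
  | nil => exact Cycle.Chain.nil s
  | cons a l _ =>
    rw [Cycle.chain_coe_cons] at hc ⊢
    refine hc.imp_of_mem_imp fun x y hx hy => h x ?_ y ?_ <;>
      simp_all [or_comm]

theorem eq_of_isChain_append_singleton {l m : List α} {a x : α} (hl : x ∉ l) (hm : x ∉ m)
    (hr : ∀ b, ∀ y ∈ l ++ [x], ∀ z ∈ m ++ [x], r b y → r b z → y = z)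
    (hal : (a :: (l ++ [x])).IsChain r) (ham : (a :: (m ++ [x])).IsChain r) : l = m := by
  induction l generalizing a m with
  | nil =>
    cases m with
    | nil => rfl
    | cons c m =>
      simp only [List.nil_append, List.cons_append, List.isChain_cons_cons] at hal ham
      exact absurd (hr a x (by simp) c (by simp) hal.1 ham.1) (List.ne_of_not_mem_cons hm)
  | cons b l ih =>
    cases m with
    | nil =>
      simp only [List.nil_append, List.cons_append, List.isChain_cons_cons] at hal ham
      exact absurd (hr a b (by simp) x (by simp) hal.1 ham.1).symm (List.ne_of_not_mem_cons hl)
    | cons c m =>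
      simp only [List.cons_append, List.isChain_cons_cons] at hal ham
      obtain rfl : b = c := hr a b (by simp) c (by simp) hal.1 ham.1
      rw [ih (List.not_mem_of_not_mem_cons hl) (List.not_mem_of_not_mem_cons hm)
        (fun d y hy z hz => hr d y (List.mem_cons_of_mem _ hy) z (List.mem_cons_of_mem _ hz))
        hal.2 ham.2]

theorem cycle_eq_of_mem {c d : Cycle α} (hcn : c.Nodup) (hdn : d.Nodup) (hc : c.Chain r)
    (hd : d.Chain r) (hr : ∀ b, ∀ y ∈ c, ∀ z ∈ d, r b y → r b z → y = z) {x : α} (hxc : x ∈ c)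
    (hxd : x ∈ d) : c = d := by
  obtain ⟨l, rfl⟩ := exists_cycle_eq_coe_cons hxc
  obtain ⟨m, rfl⟩ := exists_cycle_eq_coe_cons hxd
  rw [Cycle.chain_coe_cons] at hc hd
  rw [eq_of_isChain_append_singleton (List.nodup_cons.1 hcn).1 (List.nodup_cons.1 hdn).1
    (fun b y hy z hz => hr b y (by simpa [or_comm] using hy) z (by simpa [or_comm] using hz))
    hc hd]

theorem map_cons_eq_of_isChain {f g : α → β} {l : List α} {a x : α}
    (h : (a :: (l ++ [x])).IsChain fun y z => f y = g z) :
    (a :: l).map f = (l ++ [x]).map g := by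
  induction l generalizing a with
  | nil => simpa using h
  | cons b l ih =>
    simp only [List.cons_append, List.isChain_cons_cons] at h
    rw [List.map_cons, ih h.2, h.1, List.cons_append, List.map_cons]

theorem cycle_map_eq_of_chain {f g : α → β} {c : Cycle α}
    (h : c.Chain fun y z => f y = g z) : c.map f = c.map g := by
  induction c using Cycle.induction_on with
  | nil => rfl
  | cons a l _ =>
    rw [Cycle.chain_coe_cons] at h
    rw [Cycle.map_coe, Cycle.map_coe, map_cons_eq_of_isChain h, ← Cycle.map_coe, ← Cycle.map_coe,
      Cycle.coe_cons_eq_coe_append]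

theorem eq_of_mem_of_nodup_cycle_map {f : α → β} {c : Cycle α} (h : (c.map f).Nodup) {x y : α}
    (hx : x ∈ c) (hy : y ∈ c) (hxy : f x = f y) : x = y := by
  induction c using Quotient.inductionOn with
  | h l => exact List.inj_on_of_nodup_map (Cycle.nodup_coe_iff.1 h) hx hy hxy

end CyclicSequence

/-! ### Directed cycles and packings -/

namespace DirectedGraph

variable {V E : Type*} {G : DirectedGraph V E}

namespace DirectedCycle

variable {C D : G.DirectedCycle}

theorem chain (C : G.DirectedCycle) : C.1.Chain fun x y => G.term x = G.init y := C.2.2.1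

theorem nodup_map_init (C : G.DirectedCycle) : (C.1.map G.init).Nodup := C.2.2.2

theorem map_term (C : G.DirectedCycle) : C.1.map G.term = C.1.map G.init :=
  cycle_map_eq_of_chain C.chain

theorem nodup_map_term (C : G.DirectedCycle) : (C.1.map G.term).Nodup :=
  C.map_term ▸ C.nodup_map_init

theorem nodup (C : G.DirectedCycle) : C.1.Nodup := by
  obtain ⟨c, -, -, h⟩ := C
  induction c using Quotient.inductionOn with
  | h l => exact List.Nodup.of_map _ h

theorem exists_mem (C : G.DirectedCycle) : ∃ e, e ∈ C.1 := by
  obtain ⟨c, hnil, -, -⟩ := C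
  induction c using Cycle.induction_on with
  | nil => exact absurd rfl hnil
  | cons a l _ => exact ⟨a, Cycle.mem_coe_iff.2 List.mem_cons_self⟩

theorem mem_vertices {v : V} : v ∈ C.vertices ↔ ∃ x ∈ C.1, G.init x = v :=
  Cycle.mem_map

theorem init_mem_vertices {x : E} (hx : x ∈ C.1) : G.init x ∈ C.vertices :=
  mem_vertices.2 ⟨x, hx, rfl⟩

theorem term_mem_vertices {x : E} (hx : x ∈ C.1) : G.term x ∈ C.vertices := by
  have h : G.term x ∈ C.1.map G.term := Cycle.mem_map.2 ⟨x, hx, rfl⟩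
  rwa [C.map_term] at h

theorem eq_of_not_disjoint_vertices {S : Set E} (hS : Set.InjOn G.init S) (hC : ∀ x ∈ C.1, x ∈ S)
    (hD : ∀ x ∈ D.1, x ∈ S) (h : ¬Disjoint C.vertices D.vertices) : C = D := by
  obtain ⟨u, huC, huD⟩ := Set.not_disjoint_iff.1 h
  obtain ⟨x, hx, rfl⟩ := mem_vertices.1 huC
  obtain ⟨y, hy, hyx⟩ := mem_vertices.1 huD
  obtain rfl := hS (hD y hy) (hC x hx) hyx
  exact Subtype.ext (cycle_eq_of_mem C.nodup D.nodup C.chain D.chain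
    (fun b y hy z hz hby hbz => hS (hC y hy) (hD z hz) (hby.symm.trans hbz)) hx hy)

end DirectedCycle

theorem exists_directedCycle_mem {S : Set E} (hfin : S.Finite) (hinit : Set.InjOn G.init S)
    (hterm : Set.InjOn G.term S) (hnext : ∀ x ∈ S, ∃ y ∈ S, G.term x = G.init y) {e : E}
    (he : e ∈ S) : ∃ C : G.DirectedCycle, e ∈ C.1 ∧ ∀ x ∈ C.1, x ∈ S := by
  have := hfin.to_subtype
  choose next hnextS hnext using hnext
  let g (x : S) : S := ⟨next x x.2, hnextS x x.2⟩
  have hg (x : S) : G.term x = G.init (g x) := hnext x x.2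
  have hinj : Function.Injective g := fun x y hxy =>
    Subtype.ext (hterm x.2 y.2 (by rw [hg, hg, hxy]))
  let c : Cycle S := Function.periodicOrbit g ⟨e, he⟩
  have hper : (⟨e, he⟩ : S) ∈ Function.periodicPts g := hinj.mem_periodicPts _
  have hself : (⟨e, he⟩ : S) ∈ c := Function.self_mem_periodicOrbit hper
  have hchain : c.Chain fun x y : S => G.term x = G.init y :=
    (Function.periodicOrbit_chain' _ hper).2 fun n => by
      rw [Function.iterate_succ_apply']
      exact hg _
  have hnodup : ((c.map Subtype.val).map G.init).Nodup := by
    have h := Function.nodup_periodicOrbit (f := g) (x := ⟨e, he⟩)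
    rw [Function.periodicOrbit_def] at h
    change ((List.map _ _).map _).Nodup
    rw [List.map_map]
    exact h.map (Set.injOn_iff_injective.1 hinit)
  refine ⟨⟨c.map Subtype.val, fun h => ?_, (Cycle.chain_map _).2 hchain, hnodup⟩,
    Cycle.mem_map.2 ⟨_, hself, rfl⟩, fun x (hx : x ∈ c.map Subtype.val) => ?_⟩
  · rw [(Cycle.map_eq_nil _ _).1 h] at hself
    exact Cycle.notMem_nil _ hself
  · obtain ⟨y, -, rfl⟩ := Cycle.mem_map.1 hx
    exact y.2

/-- The set of edges of a collection of directed cycles. -/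
def edgeSet (𝒞 : Finset G.DirectedCycle) : Set E := {e | ∃ C ∈ 𝒞, e ∈ C.1}

namespace PairwiseDisjointCycles

variable {𝒞 : Finset G.DirectedCycle} (h𝒞 : G.PairwiseDisjointCycles 𝒞)
include h𝒞

theorem eq_of_mem_vertices {C D : G.DirectedCycle} (hC : C ∈ 𝒞) (hD : D ∈ 𝒞) {v : V}
    (hvC : v ∈ C.vertices) (hvD : v ∈ D.vertices) : C = D :=
  h𝒞.eq hC hD (Set.not_disjoint_iff.2 ⟨v, hvC, hvD⟩)

theorem eq_of_mem {C D : G.DirectedCycle} (hC : C ∈ 𝒞) (hD : D ∈ 𝒞) {e : E} (heC : e ∈ C.1)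
    (heD : e ∈ D.1) : C = D :=
  h𝒞.eq_of_mem_vertices hC hD (DirectedCycle.init_mem_vertices heC)
    (DirectedCycle.init_mem_vertices heD)

theorem injOn_init : Set.InjOn G.init (edgeSet 𝒞) := by
  rintro x ⟨C, hC, hx⟩ y ⟨D, hD, hy⟩ hxy
  obtain rfl := h𝒞.eq_of_mem_vertices hC hD (DirectedCycle.init_mem_vertices hx)
    (hxy ▸ DirectedCycle.init_mem_vertices hy)
  exact eq_of_mem_of_nodup_cycle_map C.nodup_map_init hx hy hxy

theorem injOn_term : Set.InjOn G.term (edgeSet 𝒞) := by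
  rintro x ⟨C, hC, hx⟩ y ⟨D, hD, hy⟩ hxy
  obtain rfl := h𝒞.eq_of_mem_vertices hC hD (DirectedCycle.term_mem_vertices hx)
    (hxy ▸ DirectedCycle.term_mem_vertices hy)
  exact eq_of_mem_of_nodup_cycle_map C.nodup_map_term hx hy hxy

theorem mem_of_subset_edgeSet {C : G.DirectedCycle} (hC : ∀ e ∈ C.1, e ∈ edgeSet 𝒞) : C ∈ 𝒞 := by
  obtain ⟨e, he⟩ := C.exists_mem
  obtain ⟨D, hD, heD⟩ := hC e he
  rwa [DirectedCycle.eq_of_not_disjoint_vertices h𝒞.injOn_init hC (fun x hx => ⟨D, hD, hx⟩)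
    (Set.not_disjoint_iff.2 ⟨_, DirectedCycle.init_mem_vertices he,
      DirectedCycle.init_mem_vertices heD⟩)]

end PairwiseDisjointCycles

theorem exists_pairwiseDisjointCycles_edgeSet_eq [Finite E] {S : Set E}
    (hinit : Set.InjOn G.init S) (hterm : Set.InjOn G.term S)
    (hnext : ∀ x ∈ S, ∃ y ∈ S, G.term x = G.init y) :
    ∃ 𝒞 : Finset G.DirectedCycle, G.PairwiseDisjointCycles 𝒞 ∧ edgeSet 𝒞 = S := by
  let cyclesIn : Set G.DirectedCycle := {C | ∀ x ∈ C.1, x ∈ S}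
  have hmem {C : G.DirectedCycle} : C ∈ cyclesIn.toFinite.toFinset ↔ ∀ x ∈ C.1, x ∈ S :=
    Set.Finite.mem_toFinset _
  refine ⟨cyclesIn.toFinite.toFinset, fun C hC D hD hne => ?_,
    Set.Subset.antisymm (fun e ⟨C, hC, he⟩ => hmem.1 hC e he) fun e he => ?_⟩
  · by_contra h
    exact hne (DirectedCycle.eq_of_not_disjoint_vertices hinit (hmem.1 hC) (hmem.1 hD) h)
  · obtain ⟨C, heC, hCS⟩ := exists_directedCycle_mem S.toFinite hinit hterm hnext he
    exact ⟨C, hmem.2 hCS, heC⟩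

/-! ### The linear subspace of a packing -/

/-- The indicator function of the edges of a directed cycle. -/
noncomputable def cycleVector (C : G.DirectedCycle) : E → ℂ := Set.indicator {e | e ∈ C.1} 1

theorem cycleVector_of_mem {C : G.DirectedCycle} {e : E} (h : e ∈ C.1) : cycleVector C e = 1 :=
  Set.indicator_of_mem (s := {e | e ∈ C.1}) h _

theorem cycleVector_of_notMem {C : G.DirectedCycle} {e : E} (h : e ∉ C.1) :
    cycleVector C e = 0 :=
  Set.indicator_of_notMem (s := {e | e ∈ C.1}) h _

/-- The linear subspace spanned by the indicator functions of the cycles of a collection. -/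
noncomputable def packingSpace (𝒞 : Finset G.DirectedCycle) : Submodule ℂ (E → ℂ) :=
  Submodule.span ℂ (cycleVector '' (𝒞 : Set G.DirectedCycle))

theorem cycleVector_mem_packingSpace {𝒞 : Finset G.DirectedCycle} {C : G.DirectedCycle}
    (hC : C ∈ 𝒞) : cycleVector C ∈ packingSpace 𝒞 :=
  Submodule.subset_span ⟨C, hC, rfl⟩

theorem mem_edgeSet_of_mem_packingSpace {𝒞 : Finset G.DirectedCycle} {v : E → ℂ}
    (hv : v ∈ packingSpace 𝒞) {e : E} (he : v e ≠ 0) : e ∈ edgeSet 𝒞 := by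
  by_contra hne
  have hle : packingSpace 𝒞 ≤ LinearMap.ker (LinearMap.proj (R := ℂ) e) := by
    refine Submodule.span_le.2 ?_
    rintro _ ⟨C, hC, rfl⟩
    exact cycleVector_of_notMem fun heC => hne ⟨C, hC, heC⟩
  exact he (hle hv)

namespace PairwiseDisjointCycles

variable {𝒜 ℬ 𝒞 : Finset G.DirectedCycle}

theorem sum_smul_cycleVector_apply (h𝒞 : G.PairwiseDisjointCycles 𝒞) (a : G.DirectedCycle → ℂ)
    {C : G.DirectedCycle} (hC : C ∈ 𝒞) {e : E} (he : e ∈ C.1) :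
    (∑ D ∈ 𝒞, a D • cycleVector D) e = a C := by
  rw [Finset.sum_apply, Finset.sum_eq_single_of_mem C hC, Pi.smul_apply, cycleVector_of_mem he,
    smul_eq_mul, mul_one]
  intro D hD hne
  rw [Pi.smul_apply, cycleVector_of_notMem fun heD => hne (h𝒞.eq_of_mem hD hC heD he), smul_zero]

theorem mem_packingSpace (h𝒞 : G.PairwiseDisjointCycles 𝒞) {v : E → ℂ}
    (hv : ∀ e, v e ≠ 0 → e ∈ edgeSet 𝒞)
    (hconst : ∀ C ∈ 𝒞, ∀ x ∈ C.1, ∀ y ∈ C.1, v x = v y) : v ∈ packingSpace 𝒞 := by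
  choose edge hedge using DirectedCycle.exists_mem (G := G)
  have hmem : ∑ C ∈ 𝒞, v (edge C) • cycleVector C ∈ packingSpace 𝒞 :=
    Submodule.sum_mem _ fun C hC => Submodule.smul_mem _ _ (cycleVector_mem_packingSpace hC)
  convert hmem
  ext e
  by_cases he : e ∈ edgeSet 𝒞
  · obtain ⟨C, hC, heC⟩ := he
    rw [h𝒞.sum_smul_cycleVector_apply _ hC heC, hconst C hC e heC _ (hedge C)]
  · rw [not_not.1 (mt (hv e) he), not_not.1 (mt (mem_edgeSet_of_mem_packingSpace hmem) he)]

theorem finrank_packingSpace (h𝒞 : G.PairwiseDisjointCycles 𝒞) :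
    Module.finrank ℂ (packingSpace 𝒞) = 𝒞.card := by
  have hindep : LinearIndepOn ℂ cycleVector (𝒞 : Set G.DirectedCycle) := by
    refine linearIndepOn_finset_iff.2 fun a ha C hC => ?_
    obtain ⟨e, he⟩ := C.exists_mem
    rw [← h𝒞.sum_smul_cycleVector_apply a hC he, ha, Pi.zero_apply]
  rw [packingSpace, Set.image_eq_range]
  exact (finrank_span_eq_card hindep).trans (Fintype.card_coe 𝒞)

theorem packingSpace_le_iff (hℬ : G.PairwiseDisjointCycles ℬ) :
    packingSpace 𝒜 ≤ packingSpace ℬ ↔ 𝒜 ⊆ ℬ := by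
  refine ⟨fun h C hC => hℬ.mem_of_subset_edgeSet fun e he => ?_,
    fun h => Submodule.span_mono (Set.image_mono (Finset.coe_subset.2 h))⟩
  refine mem_edgeSet_of_mem_packingSpace (h (cycleVector_mem_packingSpace hC)) ?_
  rw [cycleVector_of_mem he]
  exact one_ne_zero

end PairwiseDisjointCycles

variable (G) in
/-- The collection of the linear subspaces of all packings of disjoint directed cycles. -/
def packingSpaces : Set (Submodule ℂ (E → ℂ)) :=
  packingSpace '' {𝒞 : Finset G.DirectedCycle | G.PairwiseDisjointCycles 𝒞}

instance finite_packingSpaces [Finite E] : Finite G.packingSpaces :=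
  ((Set.toFinite _).image _).to_subtype

theorem bddAbove_setOf_card_pairwiseDisjointCycles [Finite E] :
    BddAbove {k | ∃ 𝒞 : Finset G.DirectedCycle, G.PairwiseDisjointCycles 𝒞 ∧ 𝒞.card = k} := by
  cases nonempty_fintype G.DirectedCycle
  refine ⟨Fintype.card G.DirectedCycle, ?_⟩
  rintro _ ⟨𝒞, -, rfl⟩
  exact Finset.card_le_univ 𝒞

theorem finrank_le_strongPackingNumber [Finite E] {W : Submodule ℂ (E → ℂ)}
    (hW : W ∈ G.packingSpaces) : Module.finrank ℂ W ≤ G.strongPackingNumber := by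
  obtain ⟨𝒞, h𝒞, rfl⟩ := hW
  rw [h𝒞.finrank_packingSpace]
  exact le_csSup bddAbove_setOf_card_pairwiseDisjointCycles ⟨𝒞, h𝒞, rfl⟩

variable (G) in
theorem exists_mem_packingSpaces_finrank_eq [Finite E] :
    ∃ W ∈ G.packingSpaces, Module.finrank ℂ W = G.strongPackingNumber := by
  have hempty : G.PairwiseDisjointCycles ∅ := by simp [PairwiseDisjointCycles]
  obtain ⟨𝒞, h𝒞, hcard⟩ : ∃ 𝒞 : Finset G.DirectedCycle,
      G.PairwiseDisjointCycles 𝒞 ∧ 𝒞.card = G.strongPackingNumber :=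
    Nat.sSup_mem (s := {k | ∃ 𝒞 : Finset G.DirectedCycle, G.PairwiseDisjointCycles 𝒞 ∧ 𝒞.card = k})
      ⟨0, ∅, hempty, Finset.card_empty⟩ bddAbove_setOf_card_pairwiseDisjointCycles
  exact ⟨_, ⟨𝒞, h𝒞, rfl⟩, h𝒞.finrank_packingSpace.trans hcard⟩

variable (G) in
theorem ncard_setOf_maximal_packingSpaces (n : ℕ) :
    {W | Maximal (· ∈ G.packingSpaces) W ∧ Module.finrank ℂ W = n}.ncard =
      G.strongSpectrum n := by
  have hle ⦃𝒜 ℬ : Finset G.DirectedCycle⦄ (_ : 𝒜 ∈ {𝒞 | G.PairwiseDisjointCycles 𝒞})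
      (hℬ : ℬ ∈ {𝒞 | G.PairwiseDisjointCycles 𝒞}) : packingSpace 𝒜 ≤ packingSpace ℬ ↔ 𝒜 ≤ ℬ :=
    PairwiseDisjointCycles.packingSpace_le_iff hℬ
  have himage : {W | Maximal (· ∈ G.packingSpaces) W ∧ Module.finrank ℂ W = n} =
      packingSpace '' {𝒞 | G.StronglyMaximal 𝒞 ∧ 𝒞.card = n} := by
    have hmaximal := image_monotone_setOfPred_maximal_mem hle
    refine Set.Subset.antisymm ?_ ?_
    · rintro W ⟨hW, hn⟩
      obtain ⟨𝒞, h𝒞, rfl⟩ := hmaximal.superset hW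
      exact ⟨𝒞, ⟨h𝒞, h𝒞.1.finrank_packingSpace.symm.trans hn⟩, rfl⟩
    · rintro _ ⟨𝒞, ⟨h𝒞, hn⟩, rfl⟩
      exact ⟨hmaximal.subset ⟨𝒞, h𝒞, rfl⟩, h𝒞.1.finrank_packingSpace.trans hn⟩
  rw [himage, strongSpectrum]
  refine Set.InjOn.ncard_image fun 𝒜 h𝒜 ℬ hℬ heq => ?_
  exact le_antisymm ((hle h𝒜.1.1 hℬ.1.1).1 heq.le) ((hle hℬ.1.1 h𝒜.1.1).1 heq.ge)

/-! ### The solutions of the strong incidence relations -/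

theorem aeval_elemSymm (s : Finset E) (l : ℕ) (v : E → ℂ) :
    aeval v (elemSymm s l) = ∑ t ∈ s.powersetCard l, ∏ x ∈ t, v x := by
  simp [elemSymm]

theorem aeval_elemSymm_one (s : Finset E) (v : E → ℂ) :
    aeval v (elemSymm s 1) = ∑ x ∈ s, v x := by
  simp [aeval_elemSymm, Finset.powersetCard_one]

open Classical in
theorem aeval_elemSymm_card_filter_ne_zero (s : Finset E) (v : E → ℂ) :
    aeval v (elemSymm s {x ∈ s | v x ≠ 0}.card) = ∏ x ∈ s with v x ≠ 0, v x := by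
  rw [aeval_elemSymm]
  refine Finset.sum_eq_single_of_mem _
    (Finset.mem_powersetCard.2 ⟨Finset.filter_subset _ _, rfl⟩) fun t ht hne => ?_
  obtain ⟨hts, htcard⟩ := Finset.mem_powersetCard.1 ht
  by_contra hprod
  have hsub : t ⊆ {x ∈ s | v x ≠ 0} := fun x hx =>
    Finset.mem_filter.2 ⟨hts hx, Finset.prod_ne_zero_iff.1 hprod x hx⟩
  exact hne (Finset.eq_of_subset_of_card_le hsub htcard.ge)

theorem forall_aeval_elemSymm_eq_zero_iff (s : Finset E) (v : E → ℂ) :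
    (∀ l, 2 ≤ l → l ≤ s.card → aeval v (elemSymm s l) = 0) ↔
      ∀ x ∈ s, ∀ y ∈ s, v x ≠ 0 → v y ≠ 0 → x = y := by
  classical
  constructor
  · intro h
    have hcard : {x ∈ s | v x ≠ 0}.card ≤ 1 := by
      by_contra! hlt
      have hzero := h _ hlt (Finset.card_le_card (Finset.filter_subset _ _))
      rw [aeval_elemSymm_card_filter_ne_zero] at hzero
      exact Finset.prod_ne_zero_iff.2 (fun x hx => (Finset.mem_filter.1 hx).2) hzero
    exact fun x hx y hy hvx hvy => Finset.card_le_one.1 hcard x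
      (Finset.mem_filter.2 ⟨hx, hvx⟩) y (Finset.mem_filter.2 ⟨hy, hvy⟩)
  · intro h l hl _
    rw [aeval_elemSymm]
    refine Finset.sum_eq_zero fun t ht => ?_
    obtain ⟨hts, rfl⟩ := Finset.mem_powersetCard.1 ht
    obtain ⟨x, hx, y, hy, hne⟩ := Finset.one_lt_card.1 hl
    by_contra hprod
    replace hprod := Finset.prod_ne_zero_iff.1 hprod
    exact hne (h x (hts hx) y (hts hy) (hprod x hx) (hprod y hy))

variable [Fintype E]

theorem mem_outEdges {u : V} {e : E} : e ∈ G.outEdges u ↔ G.init e = u := by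
  simp [outEdges]

theorem mem_inEdges {u : V} {e : E} : e ∈ G.inEdges u ↔ G.term e = u := by
  simp [inEdges]

variable (G) in
/-- The complex circulations of a directed graph: the weights on the edges for which, at each
vertex, the total weight of the outgoing edges is that of the incoming edges. -/
def circulations : Submodule ℂ (E → ℂ) where
  carrier := {v | ∀ u, ∑ x ∈ G.outEdges u, v x = ∑ x ∈ G.inEdges u, v x}
  add_mem' hv hw u := by simp only [Pi.add_apply, Finset.sum_add_distrib, hv u, hw u]
  zero_mem' _ := by simp
  smul_mem' a v hv u := by simp only [Pi.smul_apply, ← Finset.smul_sum, hv u]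

theorem mem_circulations {v : E → ℂ} :
    v ∈ G.circulations ↔ ∀ u, ∑ x ∈ G.outEdges u, v x = ∑ x ∈ G.inEdges u, v x :=
  Iff.rfl

variable (G) in
/-- A circulation whose support contains at most one edge out of, and at most one edge into, each
vertex. -/
structure IsVertexDisjointCirculation (v : E → ℂ) : Prop where
  mem_circulations : v ∈ G.circulations
  injOn_init : Set.InjOn G.init {e | v e ≠ 0}
  injOn_term : Set.InjOn G.term {e | v e ≠ 0}

theorem forall_mem_strongRelationsAt_aeval_eq_zero_iff {v : E → ℂ} {u : V} :
    (∀ f ∈ G.strongRelationsAt u, aeval v f = 0) ↔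
      ∑ x ∈ G.outEdges u, v x = ∑ x ∈ G.inEdges u, v x ∧
        (∀ x ∈ G.outEdges u, ∀ y ∈ G.outEdges u, v x ≠ 0 → v y ≠ 0 → x = y) ∧
        (∀ x ∈ G.inEdges u, ∀ y ∈ G.inEdges u, v x ≠ 0 → v y ≠ 0 → x = y) := by
  rw [← forall_aeval_elemSymm_eq_zero_iff, ← forall_aeval_elemSymm_eq_zero_iff, ← sub_eq_zero,
    ← aeval_elemSymm_one, ← aeval_elemSymm_one, ← map_sub]
  constructor
  · intro h
    exact ⟨h _ (Or.inl (Or.inl rfl)), fun l hl hcard => h _ (Or.inl (Or.inr ⟨l, hl, hcard, rfl⟩)),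
      fun l hl hcard => h _ (Or.inr ⟨l, hl, hcard, rfl⟩)⟩
  · rintro ⟨hlin, hout, hin⟩ f ((rfl | ⟨l, hl, hcard, rfl⟩) | ⟨l, hl, hcard, rfl⟩)
    · exact hlin
    · exact hout l hl hcard
    · exact hin l hl hcard

theorem forall_mem_strongIncidenceIdeal_aeval_eq_zero_iff {v : E → ℂ} :
    (∀ f ∈ G.strongIncidenceIdeal, aeval v f = 0) ↔ G.IsVertexDisjointCirculation v := by
  have hspan : (∀ f ∈ G.strongIncidenceIdeal, aeval v f = 0) ↔
      ∀ u, ∀ f ∈ G.strongRelationsAt u, aeval v f = 0 := by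
    change G.strongIncidenceIdeal ≤ RingHom.ker (aeval (R := ℤ) v) ↔ _
    rw [strongIncidenceIdeal, Ideal.span_le, Set.iUnion_subset_iff]
    rfl
  simp only [hspan, forall_mem_strongRelationsAt_aeval_eq_zero_iff, mem_outEdges, mem_inEdges,
    forall_and]
  constructor
  · rintro ⟨hlin, hout, hin⟩
    exact ⟨hlin, fun x hx y hy hxy => hout _ x hxy y rfl hx hy,
      fun x hx y hy hxy => hin _ x hxy y rfl hx hy⟩
  · rintro ⟨hlin, hout, hin⟩
    exact ⟨hlin, fun u x hx y hy hvx hvy => hout hvx hvy (hx.trans hy.symm),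
      fun u x hx y hy hvx hvy => hin hvx hvy (hx.trans hy.symm)⟩

open Classical in
theorem sum_cycleVector_filter_eq {f : E → V} {C : G.DirectedCycle} (hf : (C.1.map f).Nodup)
    (u : V) : ∑ x with f x = u, cycleVector C x = if u ∈ C.1.map f then 1 else 0 := by
  split_ifs with hu
  · obtain ⟨x, hx, rfl⟩ := Cycle.mem_map.1 hu
    rw [Finset.sum_eq_single_of_mem x (by simp), cycleVector_of_mem hx]
    intro y hy hne
    refine cycleVector_of_notMem fun hyC => hne ?_
    exact eq_of_mem_of_nodup_cycle_map hf hyC hx (Finset.mem_filter.1 hy).2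
  · refine Finset.sum_eq_zero fun x hx => cycleVector_of_notMem fun hxC => hu ?_
    exact Cycle.mem_map.2 ⟨x, hxC, (Finset.mem_filter.1 hx).2⟩

theorem cycleVector_mem_circulations (C : G.DirectedCycle) : cycleVector C ∈ G.circulations :=
  fun u => by
    rw [outEdges, inEdges, sum_cycleVector_filter_eq C.nodup_map_init,
      sum_cycleVector_filter_eq C.nodup_map_term, C.map_term]

theorem packingSpace_le_circulations (𝒞 : Finset G.DirectedCycle) :
    packingSpace 𝒞 ≤ G.circulations := by
  refine Submodule.span_le.2 ?_
  rintro _ ⟨C, -, rfl⟩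
  exact cycleVector_mem_circulations C

theorem PairwiseDisjointCycles.isVertexDisjointCirculation {𝒞 : Finset G.DirectedCycle}
    (h𝒞 : G.PairwiseDisjointCycles 𝒞) {v : E → ℂ} (hv : v ∈ packingSpace 𝒞) :
    G.IsVertexDisjointCirculation v where
  mem_circulations := packingSpace_le_circulations 𝒞 hv
  injOn_init := h𝒞.injOn_init.mono fun _ => mem_edgeSet_of_mem_packingSpace hv
  injOn_term := h𝒞.injOn_term.mono fun _ => mem_edgeSet_of_mem_packingSpace hv

namespace IsVertexDisjointCirculation

variable {v : E → ℂ} (hv : G.IsVertexDisjointCirculation v)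
include hv

theorem sum_outEdges_eq {e : E} (he : v e ≠ 0) : ∑ x ∈ G.outEdges (G.init e), v x = v e := by
  refine Finset.sum_eq_single_of_mem e (mem_outEdges.2 rfl) fun x hx hne => ?_
  by_contra hvx
  exact hne (hv.injOn_init hvx he (mem_outEdges.1 hx))

theorem sum_inEdges_eq {e : E} (he : v e ≠ 0) : ∑ x ∈ G.inEdges (G.term e), v x = v e := by
  refine Finset.sum_eq_single_of_mem e (mem_inEdges.2 rfl) fun x hx hne => ?_
  by_contra hvx
  exact hne (hv.injOn_term hvx he (mem_inEdges.1 hx))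

theorem eq_of_term_eq_init {x y : E} (hx : v x ≠ 0) (hy : v y ≠ 0) (hxy : G.term x = G.init y) :
    v x = v y := by
  rw [← hv.sum_inEdges_eq hx, hxy, ← hv.mem_circulations, hv.sum_outEdges_eq hy]

theorem exists_term_eq_init {x : E} (hx : v x ≠ 0) : ∃ y, v y ≠ 0 ∧ G.term x = G.init y := by
  have hsum : ∑ y ∈ G.outEdges (G.term x), v y = v x := by
    rw [hv.mem_circulations, hv.sum_inEdges_eq hx]
  obtain ⟨y, hy, hvy⟩ := Finset.exists_ne_zero_of_sum_ne_zero (hsum.trans_ne hx)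
  exact ⟨y, hvy, (mem_outEdges.1 hy).symm⟩

theorem eq_of_mem_directedCycle {C : G.DirectedCycle} (hC : ∀ x ∈ C.1, v x ≠ 0) {x y : E}
    (hx : x ∈ C.1) (hy : y ∈ C.1) : v x = v y := by
  have hchain : (C.1.map v).Chain Eq := (Cycle.chain_map v).2 <|
    cycle_chain_imp_of_mem C.chain fun x hx y hy => hv.eq_of_term_eq_init (hC x hx) (hC y hy)
  exact Cycle.chain_iff_pairwise.1 hchain _ (Cycle.mem_map.2 ⟨x, hx, rfl⟩) _
    (Cycle.mem_map.2 ⟨y, hy, rfl⟩)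

theorem exists_mem_packingSpace :
    ∃ 𝒞 : Finset G.DirectedCycle, G.PairwiseDisjointCycles 𝒞 ∧ v ∈ packingSpace 𝒞 := by
  obtain ⟨𝒞, h𝒞, hsupport⟩ := exists_pairwiseDisjointCycles_edgeSet_eq hv.injOn_init
    hv.injOn_term fun _ hx => hv.exists_term_eq_init hx
  refine ⟨𝒞, h𝒞, h𝒞.mem_packingSpace (fun e he => hsupport.superset he) ?_⟩
  exact fun C hC x hx y hy =>
    hv.eq_of_mem_directedCycle (fun z hz => hsupport.subset ⟨C, hC, hz⟩) hx hy

end IsVertexDisjointCirculation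

theorem isVertexDisjointCirculation_iff {v : E → ℂ} :
    G.IsVertexDisjointCirculation v ↔ ∃ W ∈ G.packingSpaces, v ∈ W := by
  constructor
  · intro hv
    obtain ⟨𝒞, h𝒞, hmem⟩ := hv.exists_mem_packingSpace
    exact ⟨_, ⟨𝒞, h𝒞, rfl⟩, hmem⟩
  · rintro ⟨_, ⟨𝒞, h𝒞, rfl⟩, hmem⟩
    exact h𝒞.isVertexDisjointCirculation hmem

theorem mk_mem_strongIncidenceSet_iff {v : E → ℂ} {hv : v ≠ 0} :
    Projectivization.mk ℂ v hv ∈ G.strongIncidenceSet ↔ ∃ W ∈ G.packingSpaces, v ∈ W := by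
  rw [← isVertexDisjointCirculation_iff]
  constructor
  · exact fun h => forall_mem_strongIncidenceIdeal_aeval_eq_zero_iff.1 fun f hf => h f hf v hv rfl
  · intro h f hf
    refine (CProj.vanishes_mk_iff f v hv).2 fun a _ => ?_
    obtain ⟨W, hW, hmem⟩ := isVertexDisjointCirculation_iff.1 h
    exact forall_mem_strongIncidenceIdeal_aeval_eq_zero_iff.2
      (isVertexDisjointCirculation_iff.2 ⟨W, hW, W.smul_mem a hmem⟩) f hf

variable (G) in
theorem strongIncidenceSet_eq_arrangement :
    G.strongIncidenceSet = CProj.arrangement G.packingSpaces :=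
  Set.ext fun p => by
    induction p using Projectivization.ind with
    | h v hv => rw [mk_mem_strongIncidenceSet_iff, CProj.mk_mem_arrangement_iff]

end DirectedGraph

theorem setOf_maximal_and_finrank_eq {K M : Type*} [DivisionRing K] [AddCommGroup M] [Module K M]
    [Module.Finite K M] {𝒲 : Set (Submodule K M)} {n : ℕ}
    (hle : ∀ W ∈ 𝒲, Module.finrank K W ≤ n) :
    {W | Maximal (· ∈ 𝒲) W ∧ Module.finrank K W = n} = {W ∈ 𝒲 | Module.finrank K W = n} := by
  refine Set.ext fun W => ⟨fun h => ⟨h.1.1, h.2⟩, fun h => ⟨⟨h.1, fun W' hW' hWW' => ?_⟩, h.2⟩⟩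
  exact (Submodule.eq_of_le_of_finrank_le hWW' ((hle W' hW').trans h.2.ge)).ge

theorem mainTheorem3_general {V E : Type*} [Fintype E] (G : DirectedGraph V E) :
    (∃ S : Set (Projectivization.Subspace ℂ (E → ℂ)), S.Finite ∧
      G.strongIncidenceSet = ⋃ L ∈ S, (L : Set (CProj E))) ∧
    CProj.HasDim G.strongIncidenceSet ((G.strongPackingNumber : ℤ) - 1) ∧
    (1 ≤ G.strongPackingNumber →
      CProj.HasDegree G.strongIncidenceSet (G.strongSpectrum G.strongPackingNumber)) ∧
    (∀ n : ℕ, 1 ≤ n →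
      {Z ∈ irreducibleComponents G.strongIncidenceSet | CProj.HasDim Z ((n : ℤ) - 1)}.encard =
        (G.strongSpectrum n : ℕ∞)) := by
  have hle (W) (hW : W ∈ G.packingSpaces) := DirectedGraph.finrank_le_strongPackingNumber hW
  have hmax := G.exists_mem_packingSpaces_finrank_eq
  rw [G.strongIncidenceSet_eq_arrangement]
  refine ⟨⟨Submodule.projectivization '' G.packingSpaces, (Set.toFinite _).image _, ?_⟩,
    CProj.hasDim_arrangement hle hmax, fun hpos => ?_, fun n hn => ?_⟩
  · rw [Set.biUnion_image, CProj.arrangement]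
  · rw [← G.ncard_setOf_maximal_packingSpaces, setOf_maximal_and_finrank_eq hle]
    obtain ⟨r, hr⟩ := Nat.exists_eq_add_of_le' hpos
    rw [hr] at hle hmax ⊢
    exact CProj.hasDegree_arrangement hle hmax
  · rw [CProj.encard_irreducibleComponents_arrangement hn, ← G.ncard_setOf_maximal_packingSpaces]
    exact (((Set.toFinite G.packingSpaces).subset fun W hW => hW.1.1).cast_ncard_eq).symm

theorem mainTheorem3 {V E : Type*} [Fintype V] [Fintype E] (G : DirectedGraph V E) :
    (∃ S : Set (Projectivization.Subspace ℂ (E → ℂ)), S.Finite ∧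
      G.strongIncidenceSet = ⋃ L ∈ S, (L : Set (CProj E))) ∧
    CProj.HasDim G.strongIncidenceSet ((G.strongPackingNumber : ℤ) - 1) ∧
    (1 ≤ G.strongPackingNumber →
      CProj.HasDegree G.strongIncidenceSet (G.strongSpectrum G.strongPackingNumber)) ∧
    (∀ n : ℕ, 1 ≤ n →
      {Z ∈ irreducibleComponents G.strongIncidenceSet | CProj.HasDim Z ((n : ℤ) - 1)}.encard =
        (G.strongSpectrum n : ℕ∞)) :=
  mainTheorem3_general G
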